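/- Let $R$ be an integrally closed domain with quotient field $K$ and finite Krull dimension $r=\dim R$. Let $O(R)$ be the set of overrings of $R$ (the subrings of $K$ containing $R$, with $R$ and $K$ included). A semistar operation on $R$ is a map $E\mapsto E^*$ from the set of nonzero $R$-submodules of $K$ to itself such that, for all nonzero $x\in K$ and all nonzero $R$-submodules $E,F$ of $K$: $(xE)^*=xE^*$; $E\subseteq F$ implies $E^*\subseteq F^*$; $E\subseteq E^*$; and $(E^*)^*=E^*$. It has finite character if $E^*=\bigcup\{F^* : F\subseteq E \text{ a nonzero finitely generated } R\text{-submodule}\}$ for every $E$. Let $SSFc(R)$ be the set of all semistar operations of finite character on $R$. The following conditions are equivalent. (i) $|O(R)|=7+\dim R$. (ii) $|SSFc(R)|=7+\dim R$. (iii) $R$ is a Prüfer domain (every nonzero finitely generated ideal is invertible), and one of the following holds: (a) $r\ge 1$, $R$ has exactly three maximal ideals $M_1,M_2,M_3$, and $\mathrm{Spec}(R)=\{P_0,\dots,P_{r-1},M_1,M_2,M_3\}$ with $0=P_0\subsetneq P_1\subsetneq\dots\subsetneq P_{r-1}\subsetneq M_1\cap M_2\cap M_3$; (b) $r\ge 5$,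 $R$ has exactly two maximal ideals $M$ and $N$, and $\mathrm{Spec}(R)=\{P_0,\dots,P_r,N\}$ with $0=P_0\subsetneq P_1\subsetneq\dots\subsetneq P_{r-1}\subsetneq P_r=M$, $P_{r-4}\nsubseteq N$ and $P_{r-5}\subsetneq N$; (c) $r\ge 2$, $R$ has exactly two maximal ideals $M$ and $N$, and $\mathrm{Spec}(R)=\{P_0,\dots,P_r,Q,N\}$ with $0=P_0\subsetneq P_1\subsetneq\dots\subsetneq P_{r-2}\subsetneq P_{r-1}\subsetneq P_r=M$, $Q\notin\{P_0,\dots,P_r\}$ and $P_{r-2}\subsetneq Q\subsetneq N$. -/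

import Mathlib

open scoped Pointwise nonZeroDivisors

/-- A Prüfer domain: an integral domain in which every nonzero finitely generated ideal is
invertible (as a fractional ideal). -/
def IsPruferDomain (R : Type*) [CommRing R] : Prop :=
  IsDomain R ∧ ∀ I : Ideal R, I ≠ ⊥ → I.FG →
    IsUnit (I : FractionalIdeal R⁰ (FractionRing R))

/-- The nonzero `R`-submodules of `K`. -/
abbrev NonzeroSubmodule (R K : Type*) [CommRing R] [Field K] [Algebra R K] : Type _ :=
  {E : Submodule R K // E ≠ ⊥}

/-- The scaled submodule `xE`, for a nonzero `x` in `K`. -/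
def NonzeroSubmodule.scale {R K : Type*} [CommRing R] [Field K] [Algebra R K]
    (x : K) (hx : x ≠ 0) (E : NonzeroSubmodule R K) : NonzeroSubmodule R K :=
  ⟨x • E.1, fun h => E.2 <| by
    refine (Submodule.eq_bot_iff _).2 fun y hy => ?_
    have hxy : x • y ∈ (x • E.1 : Submodule R K) := Submodule.smul_mem_pointwise_smul y x E.1 hy
    rw [h, Submodule.mem_bot, smul_eq_mul, mul_eq_zero] at hxy
    exact hxy.resolve_left hx⟩

/-- A semistar operation on a domain `R` with quotient field `K`: a map `E ↦ E^*` on the nonzero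
`R`-submodules of `K` such that `(xE)^* = xE^*` for `x ≠ 0`, `E ⊆ F` implies `E^* ⊆ F^*`,
`E ⊆ E^*`, and `(E^*)^* = E^*`. It is not required that `R^* = R`. -/
@[ext]
structure SemistarOperation (R K : Type*) [CommRing R] [Field K] [Algebra R K] where
  toFun : NonzeroSubmodule R K → NonzeroSubmodule R K
  map_scale : ∀ (x : K) (hx : x ≠ 0) (E : NonzeroSubmodule R K),
    toFun (E.scale x hx) = (toFun E).scale x hx
  monotone : ∀ E F : NonzeroSubmodule R K, E ≤ F → toFun E ≤ toFun F
  le_apply : ∀ E : NonzeroSubmodule R K, E ≤ toFun E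
  idempotent : ∀ E : NonzeroSubmodule R K, toFun (toFun E) = toFun E

/-- Finite character (finite type): `E^*` is the union of the `F^*`, where `F` runs over the
nonzero finitely generated `R`-submodules of `E`. -/
def SemistarOperation.IsFiniteCharacter {R K : Type*} [CommRing R] [Field K] [Algebra R K]
    (s : SemistarOperation R K) : Prop :=
  ∀ (E : NonzeroSubmodule R K) (y : K),
    y ∈ (s.toFun E).1 ↔ ∃ F : NonzeroSubmodule R K, F.1.FG ∧ F ≤ E ∧ y ∈ (s.toFun F).1

/-!
Both cardinalities reduce to a count of lower sets in the finite poset `Spec R`.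

If `R` has finitely many overrings, then for `x` in `K` two of the rings `R[x^(2^k)]` coincide,
which gives a polynomial relation with a coefficient `1` for a power of `x`. As `R` is integrally
closed, `x` or `x⁻¹` then lies in `R_m`, for every prime `m`
(`isLocallyValuation_of_finite_subalgebra`), so `R` is Prüfer. There are at least as many semistar
operations of finite character as overrings, through `T ↦ (E ↦ ET)`. Over a Prüfer domain finitely
generated modules are locally principal, and this map is bijective with inverse `* ↦ R^*`
(`IsLocallyValuation.card_subalgebra_eq_card_semistarOperation`).

Over a Prüfer domain with finite spectrum, `T ↦ {P : T ⊆ R_P}` is a bijection from the overrings to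
the nonempty lower sets of `Spec R` (`IsLocallyValuation.card_subalgebra`): `T` is the intersection
of the `R_P` that contain it, and prime avoidance recovers the lower set.

Fix a chain of primes `P 0 < ⋯ < P r` with `r = dim R`. It consists of all primes below `P r`. A
nonempty lower set is given by its part `V` off this branch and the largest `j` with `P j` in it,
and `j` ranges over an interval from `f(V)` to `r`. The empty `V` contributes `r + 1`, every other
`V` at least `2`, so the total is `7 + r` exactly when the other `V` contribute `6` altogether. This
happens as `6`, `3 + 3` or `2 + 2 + 2`, and since `Spec R` is a forest of height `r` each sum
determines the poset (`IsMaximalBranch.sum_eq_six_iff`): the cases (b), (c) and (a).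
-/

/-! ### Prüfer domains, locally -/

/-- Every localization of `R` at a prime ideal is a valuation ring, with denominators cleared: for
each prime `m` and all `a`, `b`, one of `a / b` and `b / a` can be written with a denominator
outside `m`. For domains this is equivalent to `IsPruferDomain`. -/
def IsLocallyValuation (R : Type*) [CommRing R] : Prop :=
  ∀ m : Ideal R, m.IsPrime → ∀ a b : R, ∃ s ∉ m, ∃ t, s * a = t * b ∨ s * b = t * a

theorem IsPruferDomain.isLocallyValuation {R : Type*} [CommRing R] (hR : IsPruferDomain R) :
    IsLocallyValuation R := by
  obtain ⟨_, hR⟩ := hR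
  intro m hm a b
  by_cases ha : a = 0
  · exact ⟨1, (Ideal.ne_top_iff_one m).1 hm.ne_top, 0, Or.inl (by simp [ha])⟩
  have hI : Ideal.span {a, b} ≠ ⊥ := fun h => ha <| by
    have : a ∈ Ideal.span {a, b} := Ideal.subset_span (by simp)
    rwa [h, Ideal.mem_bot] at this
  obtain ⟨J, hJ⟩ := (hR _ hI (Submodule.fg_span (Set.toFinite _))).exists_right_inv
  set L := FractionRing R
  have hint : ∀ x ∈ Ideal.span {a, b}, ∀ y ∈ J,
      ∃ c : R, algebraMap R L c = algebraMap R L x * y := by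
    intro x hx y hy
    have h := FractionalIdeal.mul_mem_mul (FractionalIdeal.mem_coeIdeal_of_mem R⁰ hx) hy
    rw [hJ] at h
    exact (FractionalIdeal.mem_one_iff _).1 h
  have hsum : ∀ z ∈ ((Ideal.span {a, b} : Ideal R) : FractionalIdeal R⁰ L) * J,
      ∃ u ∈ J, ∃ v ∈ J, z = algebraMap R L a * u + algebraMap R L b * v := by
    intro z hz
    refine FractionalIdeal.mul_induction_on hz ?_ ?_
    · intro i hi j hj
      obtain ⟨i, hi', rfl⟩ := (FractionalIdeal.mem_coeIdeal _).1 hi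
      obtain ⟨x, y, rfl⟩ := Ideal.mem_span_pair.1 hi'
      refine ⟨x • j, Submodule.smul_mem (J : Submodule R L) _ hj, y • j,
        Submodule.smul_mem (J : Submodule R L) _ hj, ?_⟩
      simp only [Algebra.smul_def, map_add, map_mul]
      ring
    · rintro _ _ ⟨u, hu, v, hv, rfl⟩ ⟨u', hu', v', hv', rfl⟩
      exact ⟨u + u', Submodule.add_mem (J : Submodule R L) hu hu', v + v',
        Submodule.add_mem (J : Submodule R L) hv hv', by ring⟩
  obtain ⟨u, hu, v, hv, huv⟩ := hsum 1 (by rw [hJ]; exact FractionalIdeal.one_mem_one _)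
  have ha' : a ∈ Ideal.span {a, b} := Ideal.subset_span (by simp)
  have hb' : b ∈ Ideal.span {a, b} := Ideal.subset_span (by simp)
  obtain ⟨au, hau⟩ := hint a ha' u hu
  obtain ⟨bu, hbu⟩ := hint b hb' u hu
  obtain ⟨av, hav⟩ := hint a ha' v hv
  obtain ⟨bv, hbv⟩ := hint b hb' v hv
  have hinj := IsFractionRing.injective R L
  have h1 : au + bv = 1 := hinj (by simp [hau, hbv, huv])
  by_cases hm1 : au ∈ m
  · refine ⟨bv, fun h => hm.ne_top ((Ideal.eq_top_iff_one m).2 (h1 ▸ m.add_mem hm1 h)), av,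
      Or.inl (hinj ?_)⟩
    rw [map_mul, map_mul, hbv, hav]
    ring
  · refine ⟨au, hm1, bu, Or.inr (hinj ?_)⟩
    rw [map_mul, map_mul, hau, hbu]
    ring

theorem IsLocallyValuation.exists_smul_eq {R K : Type*} [CommRing R] [IsDomain R] [Field K]
    [Algebra R K] [IsFractionRing R K] (hR : IsLocallyValuation R) (m : Ideal R) (hm : m.IsPrime)
    (x y : K) : ∃ s ∉ m, ∃ t : R, s • x = t • y ∨ s • y = t • x := by
  obtain ⟨a, c, hc, rfl⟩ := IsFractionRing.div_surjective (A := R) x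
  obtain ⟨b, d, hd, rfl⟩ := IsFractionRing.div_surjective (A := R) y
  have hc' : algebraMap R K c ≠ 0 := IsFractionRing.to_map_ne_zero_of_mem_nonZeroDivisors hc
  have hd' : algebraMap R K d ≠ 0 := IsFractionRing.to_map_ne_zero_of_mem_nonZeroDivisors hd
  obtain ⟨s, hs, t, h⟩ := hR m hm (a * d) (b * c)
  refine ⟨s, hs, t, h.imp (fun h => ?_) (fun h => ?_)⟩ <;>
  · have h := congrArg (algebraMap R K) h
    simp only [map_mul] at h
    simp only [Algebra.smul_def]
    field_simp
    linear_combination h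

/-- A finitely generated submodule of the quotient field is principal locally at each prime. -/
theorem IsLocallyValuation.exists_locally_generates {R K : Type*} [CommRing R] [IsDomain R]
    [Field K] [Algebra R K] [IsFractionRing R K] (hR : IsLocallyValuation R) (m : Ideal R)
    (hm : m.IsPrime) (F : Submodule R K) (hF : F.FG) :
    ∃ s ∉ m, ∃ f ∈ F, ∀ x ∈ F, ∃ c : R, s • x = c • f := by
  refine Submodule.fg_induction
    (motive := fun F _ => ∃ s ∉ m, ∃ f ∈ F, ∀ x ∈ F, ∃ c : R, s • x = c • f) ?_ ?_ F hF
  · intro x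
    refine ⟨1, (Ideal.ne_top_iff_one m).1 hm.ne_top, x, Submodule.mem_span_singleton_self x, ?_⟩
    intro y hy
    obtain ⟨c, rfl⟩ := Submodule.mem_span_singleton.1 hy
    exact ⟨c, one_smul _ _⟩
  · rintro F G _ _ ⟨s, hs, f, hf, hsf⟩ ⟨s', hs', g, hg, hsg⟩
    obtain ⟨u, hu, t, h⟩ := hR.exists_smul_eq m hm f g
    have hmem : u * s * s' ∉ m := fun h =>
      (hm.mem_or_mem h).elim (fun h => (hm.mem_or_mem h).elim hu hs) hs'
    rcases h with h | h
    · refine ⟨_, hmem, g, Submodule.mem_sup_right hg, fun x hx => ?_⟩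
      obtain ⟨y, hy, z, hz, rfl⟩ := Submodule.mem_sup.1 hx
      obtain ⟨c, hc⟩ := hsf y hy
      obtain ⟨d, hd⟩ := hsg z hz
      refine ⟨s' * c * t + u * s * d, ?_⟩
      simp only [Algebra.smul_def, map_mul, map_add] at *
      linear_combination algebraMap R K u * algebraMap R K s' * hc +
        algebraMap R K u * algebraMap R K s * hd + algebraMap R K s' * algebraMap R K c * h
    · refine ⟨_, hmem, f, Submodule.mem_sup_left hf, fun x hx => ?_⟩
      obtain ⟨y, hy, z, hz, rfl⟩ := Submodule.mem_sup.1 hx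
      obtain ⟨c, hc⟩ := hsf y hy
      obtain ⟨d, hd⟩ := hsg z hz
      refine ⟨s * d * t + u * s' * c, ?_⟩
      simp only [Algebra.smul_def, map_mul, map_add] at *
      linear_combination algebraMap R K u * algebraMap R K s' * hc +
        algebraMap R K u * algebraMap R K s * hd + algebraMap R K s * algebraMap R K d * h

theorem IsLocallyValuation.isUnit_coeIdeal {R L : Type*} [CommRing R] [IsDomain R] [Field L]
    [Algebra R L] [IsFractionRing R L] (hR : IsLocallyValuation R) {I : Ideal R} (hI : I ≠ ⊥)
    (hfg : I.FG) : IsUnit (I : FractionalIdeal R⁰ L) := by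
  have hI0 : (I : FractionalIdeal R⁰ L) ≠ 0 := FractionalIdeal.coeIdeal_ne_zero.2 hI
  refine (FractionalIdeal.mul_inv_cancel_iff_isUnit L).1 ?_
  -- `c` is the integral ideal `I * I⁻¹`; it lies in no maximal ideal because `I` is locally
  -- principal
  let c : Ideal R :=
    Submodule.comap (Algebra.linearMap R L) 
      ((I * (I : FractionalIdeal R⁰ L)⁻¹ : FractionalIdeal R⁰ L) : Submodule R L)
  have hc : c = ⊤ := by
    by_contra hne
    obtain ⟨m, hm, hcm⟩ := Ideal.exists_le_maximal c hne
    obtain ⟨s, hs, f, hf, h⟩ := hR.exists_locally_generates (K := L) m hm.isPrime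
      (IsLocalization.coeSubmodule L I) (Submodule.FG.map _ hfg)
    have hsI : ∀ x ∈ I, ∃ d : R, s • algebraMap R L x = d • f := fun x hx =>
      h _ ⟨x, hx, rfl⟩
    have hs0 : s ≠ 0 := fun h => hs (h ▸ m.zero_mem)
    have hf0 : f ≠ 0 := by
      rintro rfl
      obtain ⟨x, hx, hx0⟩ := Submodule.exists_mem_ne_zero_of_ne_bot hI
      obtain ⟨d, hd⟩ := hsI x hx
      rw [smul_zero, Algebra.smul_def, ← map_mul] at hd
      exact mul_ne_zero hs0 hx0 ((IsFractionRing.injective R L) (by simpa using hd))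
    apply hs
    apply hcm
    change algebraMap R L s ∈ (I : FractionalIdeal R⁰ L) * (I : FractionalIdeal R⁰ L)⁻¹
    have hinv : algebraMap R L s / f ∈ (I : FractionalIdeal R⁰ L)⁻¹ := by
      rw [FractionalIdeal.mem_inv_iff hI0]
      intro y hy
      obtain ⟨x, hx, rfl⟩ := (FractionalIdeal.mem_coeIdeal _).1 hy
      obtain ⟨d, hd⟩ := hsI x hx
      refine (FractionalIdeal.mem_one_iff _).2 ⟨d, ?_⟩
      simp only [Algebra.smul_def] at hd
      field_simp
      linear_combination -hd
    have := FractionalIdeal.mul_mem_mul (I := (I : FractionalIdeal R⁰ L)) hf hinv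
    rwa [mul_div_cancel₀ _ hf0] at this
  refine le_antisymm FractionalIdeal.mul_one_div_le_one ?_
  rw [FractionalIdeal.one_le]
  have : (1 : R) ∈ c := hc ▸ Submodule.mem_top
  change algebraMap R L 1 ∈ (I : FractionalIdeal R⁰ L) * (I : FractionalIdeal R⁰ L)⁻¹ at this
  rwa [map_one] at this

theorem IsLocallyValuation.isPruferDomain {R : Type*} [CommRing R] [IsDomain R]
    (hR : IsLocallyValuation R) : IsPruferDomain R :=
  ⟨inferInstance, fun _ hI hfg => hR.isUnit_coeIdeal hI hfg⟩

/-- The primes of a Prüfer domain form a forest. -/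
theorem IsLocallyValuation.le_or_le {R : Type*} [CommRing R] (hR : IsLocallyValuation R)
    {p q m : Ideal R} (hp : p.IsPrime) (hq : q.IsPrime) (hm : m.IsPrime) (hpm : p ≤ m)
    (hqm : q ≤ m) : p ≤ q ∨ q ≤ p := by
  by_contra! h
  obtain ⟨a, hap, haq⟩ := SetLike.not_le_iff_exists.1 h.1
  obtain ⟨b, hbq, hbp⟩ := SetLike.not_le_iff_exists.1 h.2
  obtain ⟨s, hs, t, h | h⟩ := hR m hm a b
  · exact (hq.mem_or_mem (h ▸ q.mul_mem_left t hbq)).elim (fun h => hs (hqm h)) haq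
  · exact (hp.mem_or_mem (h ▸ p.mul_mem_left t hap)).elim (fun h => hs (hpm h)) hbp

/-! ### Finitely many overrings force the Prüfer property -/

/-- An element annihilated by a polynomial with a coefficient outside the prime `m` lies, up to
inversion, in the localization at `m` of an integrally closed domain. -/
theorem exists_smul_eq_algebraMap_of_aeval_eq_zero {R K : Type*} [CommRing R] [IsDomain R]
    [IsIntegrallyClosed R] [Field K] [Algebra R K] [IsFractionRing R K] (m : Ideal R) (x : K)
    (n : ℕ) : ∀ p : Polynomial R, p.natDegree ≤ n → (∃ i, p.coeff i ∉ m) →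
      Polynomial.aeval x p = 0 →
      ∃ s ∉ m, ∃ c : R, s • x = algebraMap R K c ∨ algebraMap R K s = c • x := by
  induction n with
  | zero =>
    rintro p hp ⟨i, hi⟩ h
    rw [Polynomial.eq_C_of_natDegree_le_zero hp] at h hi
    rw [Polynomial.aeval_C] at h
    rw [(IsFractionRing.injective R K) (h.trans (map_zero _).symm)] at hi
    simp at hi
  | succ n ih =>
    rintro p hp hi h
    rcases Nat.lt_or_eq_of_le hp with hlt | heq
    · exact ih p (Nat.lt_succ_iff.1 hlt) hi h
    set a := p.leadingCoeff with ha
    -- `a * x` is integral, hence in `R`; it replaces the two top terms by one of lower degree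
    obtain ⟨b, hb⟩ := IsIntegrallyClosed.isIntegral_iff.1 (isIntegral_leadingCoeff_smul p x h)
    by_cases ham : a ∈ m
    swap
    · exact ⟨a, ham, b, Or.inl hb.symm⟩
    by_cases hbm : b ∈ m
    swap
    · exact ⟨b, hbm, a, Or.inr hb⟩
    have ha' : p.coeff (n + 1) = a := by rw [ha, Polynomial.leadingCoeff, heq]
    refine ih (p - Polynomial.monomial (n + 1) a + Polynomial.monomial n b) ?_ ?_ ?_
    · rw [Polynomial.natDegree_le_iff_coeff_eq_zero]
      intro N hN
      rw [Polynomial.coeff_add, Polynomial.coeff_sub, Polynomial.coeff_monomial,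
        Polynomial.coeff_monomial, if_neg hN.ne, add_zero]
      split_ifs with h1
      · rw [← h1, ha', sub_self]
      · rw [sub_zero]
        exact Polynomial.coeff_eq_zero_of_natDegree_lt (by omega)
    · obtain ⟨i, hi⟩ := hi
      refine ⟨i, fun hmem => hi ?_⟩
      rw [Polynomial.coeff_add, Polynomial.coeff_sub, Polynomial.coeff_monomial,
        Polynomial.coeff_monomial] at hmem
      have h1 : (if n + 1 = i then a else 0) ∈ m := by split_ifs <;> simp [ham]
      have h2 : (if n = i then b else 0) ∈ m := by split_ifs <;> simp [hbm]
      have := m.add_mem (m.sub_mem hmem h2) h1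
      simpa using this
    · rw [map_add, map_sub, h, Polynomial.aeval_monomial, Polynomial.aeval_monomial, hb,
        Algebra.smul_def]
      ring

/-- If the rings `R[x^(2^k)]` take only finitely many values, then `x ^ (2 ^ i) ∈ R[x ^ (2 ^ j)]`
for some `i < j`, which is a polynomial relation with a coefficient equal to `1`. -/
theorem exists_smul_eq_algebraMap_of_finite {R K : Type*} [CommRing R] [IsDomain R]
    [IsIntegrallyClosed R] [Field K] [Algebra R K] [IsFractionRing R K]
    [Finite (Subalgebra R K)] (m : Ideal R) (hm : m.IsPrime) (x : K) :
    ∃ s ∉ m, ∃ c : R, s • x = algebraMap R K c ∨ algebraMap R K s = c • x := by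
  have h1m : (1 : R) ∉ m := (Ideal.ne_top_iff_one m).1 hm.ne_top
  rcases eq_or_ne x 0 with rfl | hx
  · exact ⟨1, h1m, 0, Or.inl (by simp)⟩
  obtain ⟨i, j, hij, h⟩ : ∃ i j : ℕ, i < j ∧
      Algebra.adjoin R {x ^ 2 ^ i} = Algebra.adjoin R {x ^ 2 ^ j} := by
    obtain ⟨i, j, hne, h⟩ :=
      Finite.exists_ne_map_eq_of_infinite (fun k : ℕ => Algebra.adjoin R {x ^ 2 ^ k})
    rcases lt_or_gt_of_ne hne with hlt | hlt
    · exact ⟨i, j, hlt, h⟩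
    · exact ⟨j, i, hlt, h.symm⟩
  obtain ⟨k, rfl⟩ := Nat.exists_eq_add_of_lt hij
  have hy : x ^ 2 ^ i ∈ Algebra.adjoin R {(x ^ 2 ^ i) ^ 2 ^ (k + 1)} := by
    rw [← pow_mul, ← pow_add, ← add_assoc, ← h]
    exact Algebra.subset_adjoin rfl
  rw [Algebra.adjoin_singleton_eq_range_aeval] at hy
  obtain ⟨f, hf⟩ := hy
  obtain ⟨s, hs, c, hc⟩ := exists_smul_eq_algebraMap_of_aeval_eq_zero m (x ^ 2 ^ i) _
    (Polynomial.X - Polynomial.expand R (2 ^ (k + 1)) f) le_rfl ⟨1, by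
      rw [Polynomial.coeff_sub, Polynomial.coeff_X_one, Polynomial.coeff_expand (by positivity),
        if_neg, sub_zero]
      · exact h1m
      · rw [Nat.dvd_one]
        exact (Nat.one_lt_two_pow (by omega)).ne'⟩ (by
      rw [map_sub, Polynomial.aeval_X, Polynomial.expand_aeval, sub_eq_zero]
      exact hf.symm)
  have hpos : 0 < 2 ^ i := by positivity
  obtain ⟨N, hN⟩ : ∃ N, 2 ^ i = N + 1 := ⟨2 ^ i - 1, by omega⟩
  rw [hN] at hc
  refine ⟨s, hs, ?_⟩
  rcases hc with hc | hc
  · obtain ⟨d, hd⟩ := IsIntegrallyClosed.exists_algebraMap_eq_of_isIntegral_pow (R := R)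
      (x := s • x) (n := N + 1) (by omega) (by
        rw [smul_pow, pow_succ, mul_smul, hc, Algebra.smul_def, ← map_mul]
        exact isIntegral_algebraMap)
    exact ⟨d, Or.inl hd.symm⟩
  · obtain ⟨d, hd⟩ := IsIntegrallyClosed.exists_algebraMap_eq_of_isIntegral_pow (R := R)
      (x := algebraMap R K s * x⁻¹) (n := N + 1) (by omega) (by
        have : (algebraMap R K s * x⁻¹) ^ (N + 1) = algebraMap R K (s ^ N * c) := by
          have hx' : x ^ (N + 1) * x⁻¹ ^ (N + 1) = 1 := by
            rw [← mul_pow, mul_inv_cancel₀ hx, one_pow]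
          rw [Algebra.smul_def] at hc
          rw [mul_pow, map_mul, map_pow]
          linear_combination algebraMap R K s ^ N * x⁻¹ ^ (N + 1) * hc +
            algebraMap R K s ^ N * algebraMap R K c * hx'
        rw [this]
        exact isIntegral_algebraMap)
    exact ⟨d, Or.inr (by rw [Algebra.smul_def, hd, inv_mul_cancel_right₀ hx])⟩

theorem isLocallyValuation_of_finite_subalgebra {R K : Type*} [CommRing R] [IsDomain R]
    [IsIntegrallyClosed R] [Field K] [Algebra R K] [IsFractionRing R K]
    [Finite (Subalgebra R K)] : IsLocallyValuation R := by
  intro m hm a b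
  rcases eq_or_ne b 0 with rfl | hb
  · exact ⟨1, (Ideal.ne_top_iff_one m).1 hm.ne_top, 0, Or.inr (by simp)⟩
  have hinj := IsFractionRing.injective R K
  have hb' : algebraMap R K b ≠ 0 := (map_ne_zero_iff _ hinj).2 hb
  obtain ⟨s, hs, c, h⟩ :=
    exists_smul_eq_algebraMap_of_finite m hm (algebraMap R K a / algebraMap R K b)
  refine ⟨s, hs, c, h.imp (fun h => hinj ?_) (fun h => hinj ?_)⟩
  · rw [Algebra.smul_def] at h
    field_simp at h
    simpa [mul_comm] using h
  · rw [Algebra.smul_def] at h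
    field_simp at h
    simpa [mul_comm] using h

/-! ### Semistar operations and overrings -/

/-- The module `R`, viewed inside the quotient field. -/
def NonzeroSubmodule.unit (R K : Type*) [CommRing R] [Field K] [Algebra R K] :
    NonzeroSubmodule R K :=
  ⟨1, fun h => one_ne_zero (α := K) <| by
    have h1 : (1 : K) ∈ (1 : Submodule R K) := Submodule.one_le.1 le_rfl
    rwa [h, Submodule.mem_bot] at h1⟩

theorem NonzeroSubmodule.le_mul_toSubmodule {R K : Type*} [CommRing R] [Field K] [Algebra R K]
    (E : Submodule R K) (T : Subalgebra R K) : E ≤ E * Subalgebra.toSubmodule T := fun e he => by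
  simpa using Submodule.mul_mem_mul he ((Subalgebra.mem_toSubmodule T).2 T.one_mem)

theorem NonzeroSubmodule.mem_mul_toSubmodule_of_le {R K : Type*} [CommRing R] [Field K]
    [Algebra R K] {E F : Submodule R K} {T : Subalgebra R K} (h : E ≤ F) {y : K}
    (hy : y ∈ E * Subalgebra.toSubmodule T) : y ∈ F * Subalgebra.toSubmodule T :=
  mul_le_mul' h le_rfl hy

/-- The semistar operation `E ↦ ET` given by an overring `T`. -/
def SemistarOperation.ofSubalgebra {R K : Type*} [CommRing R] [Field K] [Algebra R K]
    (T : Subalgebra R K) : SemistarOperation R K where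
  toFun E := ⟨E.1 * Subalgebra.toSubmodule T, fun h => E.2 <|
    le_bot_iff.1 ((NonzeroSubmodule.le_mul_toSubmodule E.1 T).trans_eq h)⟩
  map_scale x hx E := by
    have key : ∀ F : Submodule R K, x • F = Submodule.span R {x} * F := fun F => by
      ext y
      rw [Submodule.mem_smul_pointwise_iff_exists, Submodule.mem_span_singleton_mul]
      rfl
    apply Subtype.ext
    change (x • E.1) * _ = x • (E.1 * _)
    rw [key, key, mul_assoc]
  monotone E F h _ hy := NonzeroSubmodule.mem_mul_toSubmodule_of_le h hy
  le_apply E := NonzeroSubmodule.le_mul_toSubmodule E.1 T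
  idempotent E := Subtype.ext <| by
    change E.1 * _ * _ = E.1 * _
    rw [mul_assoc, T.isIdempotentElem_toSubmodule.eq]

theorem SemistarOperation.isFiniteCharacter_ofSubalgebra {R K : Type*} [CommRing R] [Field K]
    [Algebra R K] (T : Subalgebra R K) : (ofSubalgebra T).IsFiniteCharacter := by
  intro E y
  constructor
  · intro hy
    change y ∈ E.1 * Subalgebra.toSubmodule T at hy
    obtain ⟨F, hF, hFE, hy⟩ : ∃ F : Submodule R K, F.FG ∧ F ≤ E.1 ∧
        y ∈ F * Subalgebra.toSubmodule T := by
      induction hy using Submodule.mul_induction_on' with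
      | mem_mul_mem e he t ht =>
        exact ⟨Submodule.span R {e}, Submodule.fg_span_singleton e,
          (Submodule.span_singleton_le_iff_mem _ _).2 he,
          Submodule.mul_mem_mul (Submodule.mem_span_singleton_self e) ht⟩
      | add a _ b _ ha hb =>
        obtain ⟨F, hF, hFE, ha⟩ := ha
        obtain ⟨G, hG, hGE, hb⟩ := hb
        exact ⟨F ⊔ G, hF.sup hG, sup_le hFE hGE, add_mem
          (NonzeroSubmodule.mem_mul_toSubmodule_of_le le_sup_left ha)
          (NonzeroSubmodule.mem_mul_toSubmodule_of_le le_sup_right hb)⟩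
    -- enlarging `F` by a nonzero element of `E` makes it nonzero
    obtain ⟨e, he, he0⟩ := Submodule.exists_mem_ne_zero_of_ne_bot E.2
    refine ⟨⟨F ⊔ Submodule.span R {e}, fun h => he0 ?_⟩, hF.sup (Submodule.fg_span_singleton e),
      sup_le hFE ((Submodule.span_singleton_le_iff_mem _ _).2 he),
      NonzeroSubmodule.mem_mul_toSubmodule_of_le le_sup_left hy⟩
    have := (le_sup_right : Submodule.span R {e} ≤ F ⊔ _) (Submodule.mem_span_singleton_self e)
    rwa [h, Submodule.mem_bot] at this
  · rintro ⟨F, -, hFE, hy⟩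
    exact (ofSubalgebra T).monotone F E hFE hy

theorem SemistarOperation.ofSubalgebra_injective {R K : Type*} [CommRing R] [Field K]
    [Algebra R K] : Function.Injective (ofSubalgebra : Subalgebra R K → SemistarOperation R K) := by
  intro T T' h
  have h1 := congrArg (fun s => (s.toFun (NonzeroSubmodule.unit R K)).1) h
  change 1 * Subalgebra.toSubmodule T = 1 * Subalgebra.toSubmodule T' at h1
  rw [one_mul, one_mul] at h1
  exact Subalgebra.toSubmodule_injective h1

theorem SemistarOperation.mul_mem_apply {R K : Type*} [CommRing R] [Field K] [Algebra R K]
    (s : SemistarOperation R K) (E : NonzeroSubmodule R K) {x t : K} (hx : x ∈ E.1)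
    (ht : t ∈ (s.toFun (NonzeroSubmodule.unit R K)).1) : x * t ∈ (s.toFun E).1 := by
  rcases eq_or_ne x 0 with rfl | hx0
  · simp
  have hle : (NonzeroSubmodule.unit R K).scale x hx0 ≤ E := by
    intro y hy
    obtain ⟨z, hz, rfl⟩ := Submodule.mem_smul_pointwise_iff_exists y x _ |>.1 hy
    obtain ⟨c, rfl⟩ := Submodule.mem_one.1 hz
    rw [smul_eq_mul, mul_comm, ← Algebra.smul_def]
    exact E.1.smul_mem c hx
  have h := s.monotone _ _ hle
  rw [s.map_scale] at h
  exact h (Submodule.smul_mem_pointwise_smul t x _ ht)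

/-- The overring `R^*`. -/
def SemistarOperation.closureOfUnit {R K : Type*} [CommRing R] [Field K] [Algebra R K]
    (s : SemistarOperation R K) : Subalgebra R K where
  carrier := (s.toFun (NonzeroSubmodule.unit R K)).1
  mul_mem' {x t} hx ht := by
    have h := s.mul_mem_apply _ hx ht
    rwa [s.idempotent] at h
  add_mem' hx hy := add_mem hx hy
  algebraMap_mem' c := s.le_apply (NonzeroSubmodule.unit R K) (Submodule.mem_one.2 ⟨c, rfl⟩)

/-- On a finitely generated module over a Prüfer domain every semistar operation is extension of
scalars to `R^*`, because such a module is locally principal. -/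
theorem IsLocallyValuation.apply_eq_of_fg {R K : Type*} [CommRing R] [IsDomain R] [Field K]
    [Algebra R K] [IsFractionRing R K] (hR : IsLocallyValuation R) (s : SemistarOperation R K)
    (F : NonzeroSubmodule R K) (hF : F.1.FG) :
    s.toFun F = (SemistarOperation.ofSubalgebra s.closureOfUnit).toFun F := by
  refine le_antisymm ?_ ?_
  · intro y hy
    change y ∈ F.1 * Subalgebra.toSubmodule s.closureOfUnit
    set G := F.1 * Subalgebra.toSubmodule s.closureOfUnit
    let I : Ideal R := G.comap (LinearMap.toSpanSingleton R K y)
    have hI : I = ⊤ := by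
      by_contra hne
      obtain ⟨m, hm, hIm⟩ := Ideal.exists_le_maximal I hne
      obtain ⟨a, ha, f, hf, h⟩ := hR.exists_locally_generates (K := K) m hm.isPrime F.1 hF
      have hinj := IsFractionRing.injective R K
      have ha0 : algebraMap R K a ≠ 0 :=
        (map_ne_zero_iff _ hinj).2 fun h => ha (h ▸ m.zero_mem)
      have hf0 : f ≠ 0 := by
        rintro rfl
        obtain ⟨x, hx, hx0⟩ := Submodule.exists_mem_ne_zero_of_ne_bot F.2
        obtain ⟨c, hc⟩ := h x hx
        rw [smul_zero, Algebra.smul_def] at hc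
        exact mul_ne_zero ha0 hx0 hc
      apply ha
      apply hIm
      have hle : F.scale _ ha0 ≤ (NonzeroSubmodule.unit R K).scale f hf0 := by
        intro z hz
        obtain ⟨x, hx, rfl⟩ := Submodule.mem_smul_pointwise_iff_exists z _ _ |>.1 hz
        obtain ⟨c, hc⟩ := h x hx
        refine Submodule.mem_smul_pointwise_iff_exists _ _ _ |>.2
          ⟨algebraMap R K c, Submodule.mem_one.2 ⟨c, rfl⟩, ?_⟩
        rw [smul_eq_mul, smul_eq_mul, mul_comm, ← Algebra.smul_def, ← hc, Algebra.smul_def]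
      have hle' := s.monotone _ _ hle
      rw [s.map_scale, s.map_scale] at hle'
      obtain ⟨t, ht, hty⟩ := Submodule.mem_smul_pointwise_iff_exists _ _ _ |>.1
        (hle' (Submodule.smul_mem_pointwise_smul y _ _ hy))
      change a • y ∈ G
      rw [Algebra.smul_def, ← smul_eq_mul, ← hty]
      exact Submodule.mul_mem_mul hf ht
    have h1 : (1 : R) ∈ I := hI ▸ Submodule.mem_top
    change (1 : R) • y ∈ G at h1
    rwa [one_smul] at h1
  · exact Submodule.mul_le.2 fun x hx t ht => s.mul_mem_apply F hx ht

theorem IsLocallyValuation.eq_ofSubalgebra {R K : Type*} [CommRing R] [IsDomain R] [Field K]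
    [Algebra R K] [IsFractionRing R K] (hR : IsLocallyValuation R) (s : SemistarOperation R K)
    (hs : s.IsFiniteCharacter) : SemistarOperation.ofSubalgebra s.closureOfUnit = s := by
  ext E y
  rw [hs E y, SemistarOperation.isFiniteCharacter_ofSubalgebra _ E y]
  refine exists_congr fun F => and_congr_right fun hF => ?_
  rw [hR.apply_eq_of_fg s F hF]

theorem card_subalgebra_le_card_semistarOperation {R K : Type*} [CommRing R] [Field K]
    [Algebra R K] : ENat.card (Subalgebra R K) ≤
      ENat.card {s : SemistarOperation R K // s.IsFiniteCharacter} :=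
  ENat.card_le_card_of_injective
    (f := fun T => ⟨_, SemistarOperation.isFiniteCharacter_ofSubalgebra T⟩)
    fun _ _ h => SemistarOperation.ofSubalgebra_injective (congrArg Subtype.val h)

theorem IsLocallyValuation.card_subalgebra_eq_card_semistarOperation {R K : Type*} [CommRing R]
    [IsDomain R] [Field K] [Algebra R K] [IsFractionRing R K] (hR : IsLocallyValuation R) :
    ENat.card (Subalgebra R K) =
      ENat.card {s : SemistarOperation R K // s.IsFiniteCharacter} :=
  le_antisymm card_subalgebra_le_card_semistarOperation <|
    ENat.card_le_card_of_injective (f := fun s => s.1.closureOfUnit) fun s s' h => Subtype.ext <| by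
      rw [← hR.eq_ofSubalgebra s.1 s.2, ← hR.eq_ofSubalgebra s'.1 s'.2]
      exact congrArg _ h

/-! ### Overrings and lower sets of primes -/

/-- The subsets of `S` that are closed downwards inside `S`. -/
def lowerSubsets {α : Type*} [LE α] (S : Set α) : Set (Set α) :=
  {L | L ⊆ S ∧ ∀ x ∈ L, ∀ y ∈ S, y ≤ x → y ∈ L}

/-- The intersection inside `K` of the localizations of `R` at the prime ideals that belong
to `L`. -/
def iInfLocalization {R : Type*} (K : Type*) [CommRing R] [Field K] [Algebra R K]
    (L : Set (Ideal R)) : Subalgebra R K where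
  carrier := {x | ∀ P ∈ L, P.IsPrime → ∃ s ∉ P, ∃ c : R, s • x = algebraMap R K c}
  mul_mem' {x y} hx hy P hP hp := by
    obtain ⟨s, hs, c, hc⟩ := hx P hP hp
    obtain ⟨t, ht, d, hd⟩ := hy P hP hp
    refine ⟨s * t, fun h => (hp.mem_or_mem h).elim hs ht, c * d, ?_⟩
    rw [map_mul, ← hc, ← hd, smul_mul_smul_comm]
  add_mem' {x y} hx hy P hP hp := by
    obtain ⟨s, hs, c, hc⟩ := hx P hP hp
    obtain ⟨t, ht, d, hd⟩ := hy P hP hp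
    refine ⟨s * t, fun h => (hp.mem_or_mem h).elim hs ht, t * c + s * d, ?_⟩
    simp only [Algebra.smul_def, map_mul, map_add] at *
    linear_combination algebraMap R K t * hc + algebraMap R K s * hd
  algebraMap_mem' c P _ hp := ⟨1, (Ideal.ne_top_iff_one P).1 hp.ne_top, c, one_smul _ _⟩

/-- The prime ideals `P` of `R` for which the overring `T` lies in the localization of `R`
at `P`. -/
def primesOfOverring {R K : Type*} [CommRing R] [Field K] [Algebra R K] (T : Subalgebra R K) :
    Set (Ideal R) :=
  {P | P.IsPrime ∧ ∀ x ∈ T, ∃ s ∉ P, ∃ c : R, s • x = algebraMap R K c}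

theorem mem_primesOfOverring_iInfLocalization {R K : Type*} [CommRing R] [Field K] [Algebra R K]
    {L : Set (Ideal R)} {P : Ideal R} (hP : P ∈ L) (hp : P.IsPrime) :
    P ∈ primesOfOverring (iInfLocalization K L) :=
  ⟨hp, fun _ hx => hx P hP hp⟩

/-- An element of `Q` outside every member of `L` has its inverse in the intersection of the
localizations at `L`, but not in the localization at `Q`. -/
theorem exists_mem_of_mem_primesOfOverring {R K : Type*} [CommRing R] [IsDomain R] [Field K]
    [Algebra R K] [IsFractionRing R K] {L : Set (Ideal R)} {Q : Ideal R}
    (hQ : Q ∈ primesOfOverring (iInfLocalization K L)) {q : R} (hq : q ∈ Q)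
    (hL : L.Nonempty) : ∃ P ∈ L, q ∈ P := by
  by_contra! h
  obtain ⟨P₀, hP₀⟩ := hL
  have hinj := IsFractionRing.injective R K
  have hq0 : algebraMap R K q ≠ 0 :=
    (map_ne_zero_iff _ hinj).2 fun h0 => h P₀ hP₀ (h0 ▸ P₀.zero_mem)
  obtain ⟨s, hs, c, hc⟩ := hQ.2 (algebraMap R K q)⁻¹ fun P hP _ =>
    ⟨q, h P hP, 1, by rw [Algebra.smul_def, mul_inv_cancel₀ hq0, map_one]⟩
  apply hs
  have : s = c * q := hinj <| by
    rw [map_mul, ← hc, Algebra.smul_def, inv_mul_cancel_right₀ hq0]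
  exact this ▸ Q.mul_mem_left c hq

theorem primesOfOverring_mem_lowerSubsets {R K : Type*} [CommRing R] [Field K] [Algebra R K]
    (T : Subalgebra R K) : primesOfOverring T ∈ lowerSubsets {I : Ideal R | I.IsPrime} := by
  refine ⟨fun P hP => hP.1, fun P hP Q hQ hQP => ⟨hQ, fun x hx => ?_⟩⟩
  obtain ⟨s, hs, h⟩ := hP.2 x hx
  exact ⟨s, fun h => hs (hQP h), h⟩

theorem bot_mem_primesOfOverring {R K : Type*} [CommRing R] [IsDomain R] [Field K] [Algebra R K]
    [IsFractionRing R K] (T : Subalgebra R K) : ⊥ ∈ primesOfOverring T := by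
  refine ⟨Ideal.isPrime_bot, fun x _ => ?_⟩
  obtain ⟨a, b, hb, rfl⟩ := IsFractionRing.div_surjective (A := R) x
  refine ⟨b, fun h => nonZeroDivisors.ne_zero hb h, a, ?_⟩
  rw [Algebra.smul_def, mul_div_cancel₀]
  exact IsFractionRing.to_map_ne_zero_of_mem_nonZeroDivisors hb

/-- Over a Prüfer domain, the contraction to `R` of a prime of an overring `T` is one of the primes
`P` with `T ⊆ R_P`, so `T` is the intersection of these localizations. -/
theorem IsLocallyValuation.iInfLocalization_primesOfOverring {R K : Type*} [CommRing R]
    [IsDomain R] [Field K] [Algebra R K] [IsFractionRing R K] (hR : IsLocallyValuation R)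
    (T : Subalgebra R K) : iInfLocalization K (primesOfOverring T) = T := by
  refine le_antisymm (fun x hx => ?_) (fun x hx P hP _ => hP.2 x hx)
  let I : Ideal T :=
    { carrier := {t | (t : K) * x ∈ T}
      add_mem' := fun {a b} ha hb => by
        change ((a + b : T) : K) * x ∈ T
        rw [Subalgebra.coe_add, add_mul]
        exact add_mem ha hb
      zero_mem' := by simp
      smul_mem' := fun c a ha => by
        change ((c * a : T) : K) * x ∈ T
        rw [Subalgebra.coe_mul, mul_assoc]
        exact mul_mem c.2 ha }
  have hI : I = ⊤ := by
    by_contra hne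
    obtain ⟨n, hn, hIn⟩ := Ideal.exists_le_maximal I hne
    have hnp := hn.isPrime
    have hp : (n.comap (algebraMap R T)).IsPrime := inferInstance
    have hP : n.comap (algebraMap R T) ∈ primesOfOverring T := by
      refine ⟨hp, fun t ht => ?_⟩
      obtain ⟨s, hs, c, h | h⟩ := hR.exists_smul_eq (K := K) _ hp t 1
      · exact ⟨s, hs, c, by rw [h, Algebra.smul_def, mul_one]⟩
      · refine ⟨c, fun hc => hs ?_, s, by rw [← h, Algebra.smul_def, mul_one]⟩
        have h' : algebraMap R T s = algebraMap R T c * ⟨t, ht⟩ := Subtype.ext <| by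
          simpa [Algebra.smul_def] using h
        rw [Ideal.mem_comap, h']
        exact n.mul_mem_right _ hc
    obtain ⟨s, hs, c, hc⟩ := hx _ hP hp
    apply hs
    apply hIn
    change algebraMap R K s * x ∈ T
    rw [← Algebra.smul_def, hc]
    exact T.algebraMap_mem c
  have h1 : (1 : T) ∈ I := hI ▸ Submodule.mem_top
  change ((1 : T) : K) * x ∈ T at h1
  simpa using h1

/-- Prime avoidance: a finite nonempty lower set of primes is recovered from the intersection of
its localizations. -/
theorem primesOfOverring_iInfLocalization {R K : Type*} [CommRing R] [IsDomain R] [Field K]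
    [Algebra R K] [IsFractionRing R K] {L : Set (Ideal R)} (hfin : L.Finite)
    (hL : L ∈ lowerSubsets {I : Ideal R | I.IsPrime}) (hne : L.Nonempty) :
    primesOfOverring (iInfLocalization K L) = L := by
  refine Set.Subset.antisymm (fun Q hQ => ?_)
    fun P hP => mem_primesOfOverring_iInfLocalization hP (hL.1 hP)
  obtain ⟨P, hP, hQP⟩ := (Ideal.subset_union_prime (s := hfin.toFinset) (f := id) ⊥ ⊥
    (fun P hP _ _ => hL.1 (hfin.mem_toFinset.1 hP)) (I := Q)).1 fun q hq => by
      obtain ⟨P, hP, hqP⟩ := exists_mem_of_mem_primesOfOverring hQ hq hne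
      simp only [Set.Finite.coe_toFinset, id_eq, Set.mem_iUnion]
      exact ⟨P, hP, hqP⟩
  exact hL.2 P (hfin.mem_toFinset.1 hP) Q hQ.1 hQP

theorem IsLocallyValuation.card_subalgebra {R K : Type*} [CommRing R] [IsDomain R] [Field K]
    [Algebra R K] [IsFractionRing R K] (hR : IsLocallyValuation R)
    (hfin : {I : Ideal R | I.IsPrime}.Finite) :
    ENat.card (Subalgebra R K) =
      ENat.card {L // L ∈ lowerSubsets {I : Ideal R | I.IsPrime} ∧ L.Nonempty} :=
  ENat.card_congr
    { toFun := fun T => ⟨primesOfOverring T, primesOfOverring_mem_lowerSubsets T, ⊥,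
        bot_mem_primesOfOverring T⟩
      invFun := fun L => iInfLocalization K L.1
      left_inv := fun T => hR.iInfLocalization_primesOfOverring T
      right_inv := fun L => Subtype.ext <|
        primesOfOverring_iInfLocalization (hfin.subset L.2.1.1) L.2.1 L.2.2 }

theorem finite_setOf_isPrime_of_finite_subalgebra {R K : Type*} [CommRing R] [IsDomain R] [Field K]
    [Algebra R K] [IsFractionRing R K] [Finite (Subalgebra R K)] :
    {I : Ideal R | I.IsPrime}.Finite := by
  have hle : ∀ P : Ideal R, ∀ Q ∈ primesOfOverring (iInfLocalization K {P}), Q ≤ P := by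
    intro P Q hQ q hq
    obtain ⟨_, rfl, h⟩ := exists_mem_of_mem_primesOfOverring hQ hq (Set.singleton_nonempty P)
    exact h
  refine Set.Finite.of_injOn (f := fun P => iInfLocalization K {P}) (Set.mapsTo_univ _ _) ?_
    Set.finite_univ
  intro P hP Q hQ h
  change iInfLocalization K {P} = iInfLocalization K {Q} at h
  have h1 := mem_primesOfOverring_iInfLocalization (K := K) (Set.mem_singleton P) hP
  have h2 := mem_primesOfOverring_iInfLocalization (K := K) (Set.mem_singleton Q) hQ
  exact le_antisymm (hle Q P (h ▸ h1)) (hle P Q (h ▸ h2))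

/-! ### Counting lower sets along a maximal branch -/

/-- In the set `S`, whose least element is `P 0`, the elements below the maximal element `P r` are
exactly `P 0 < P 1 < ⋯ < P r`. -/
structure IsMaximalBranch {α : Type*} [PartialOrder α] (S : Set α) (r : ℕ) (P : ℕ → α) :
    Prop where
  strictMonoOn : StrictMonoOn P (Set.Iic r)
  mem_and_le_iff : ∀ x, x ∈ S ∧ x ≤ P r ↔ ∃ i ≤ r, P i = x
  bot_le : ∀ x ∈ S, P 0 ≤ x
  eq_of_le : ∀ x ∈ S, P r ≤ x → x = P r

/-- The elements of `S` that do not lie on the branch below `P r`. -/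
def offBranch {α : Type*} [PartialOrder α] (S : Set α) (r : ℕ) (P : ℕ → α) : Set α :=
  {x ∈ S | ¬ x ≤ P r}

/-- The indices `j` for which adjoining `P 0, …, P j` to the set `V` of elements off the branch
captures every branch element below a member of `V`. -/
def cutoffs {α : Type*} [PartialOrder α] (r : ℕ) (P : ℕ → α) (V : Set α) : Set ℕ :=
  {j | j ≤ r ∧ ∀ v ∈ V, ∀ i ≤ r, P i ≤ v → i ≤ j}

theorem finite_lowerSubsets {α : Type*} [LE α] {S : Set α} (hS : S.Finite) :
    (lowerSubsets S).Finite :=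
  hS.finite_subsets.subset fun _ hL => hL.1

theorem empty_mem_lowerSubsets {α : Type*} [LE α] (S : Set α) : ∅ ∈ lowerSubsets S :=
  ⟨Set.empty_subset _, by simp⟩

theorem union_mem_lowerSubsets {α : Type*} [LE α] {S V W : Set α} (hV : V ∈ lowerSubsets S)
    (hW : W ∈ lowerSubsets S) : V ∪ W ∈ lowerSubsets S :=
  ⟨Set.union_subset hV.1 hW.1, fun x hx y hy h =>
    hx.imp (fun hx => hV.2 x hx y hy h) (fun hx => hW.2 x hx y hy h)⟩

theorem principal_mem_lowerSubsets {α : Type*} [PartialOrder α] (S : Set α) (u : α) :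
    {w ∈ S | w ≤ u} ∈ lowerSubsets S :=
  ⟨fun _ h => h.1, fun _ hx _ hy h => ⟨hy, h.trans hx.2⟩⟩

theorem principal_injOn {α : Type*} [PartialOrder α] {S : Set α} {u v : α} (hu : u ∈ S)
    (hv : v ∈ S) (h : {w ∈ S | w ≤ u} = {w ∈ S | w ≤ v}) : u = v :=
  le_antisymm (h ▸ (⟨hu, le_rfl⟩ : u ∈ {w ∈ S | w ≤ u}) : u ∈ {w ∈ S | w ≤ v}).2
    (h ▸ (⟨hv, le_rfl⟩ : v ∈ {w ∈ S | w ≤ v}) : v ∈ {w ∈ S | w ≤ u}).2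

theorem finite_cutoffs {α : Type*} [PartialOrder α] (r : ℕ) (P : ℕ → α) (V : Set α) :
    (cutoffs r P V).Finite :=
  (Set.finite_Iic r).subset fun _ h => h.1

theorem ncard_cutoffs_empty {α : Type*} [PartialOrder α] (r : ℕ) (P : ℕ → α) :
    (cutoffs r P ∅).ncard = r + 1 := by
  have : cutoffs r P ∅ = ↑(Finset.Iic r) := by ext; simp [cutoffs]
  rw [this, Set.ncard_coe_finset, Nat.card_Iic]

namespace IsMaximalBranch

variable {α : Type*} [PartialOrder α] {S : Set α} {r : ℕ} {P : ℕ → α}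

theorem mem (h : IsMaximalBranch S r P) {i : ℕ} (hi : i ≤ r) : P i ∈ S :=
  ((h.mem_and_le_iff _).2 ⟨i, hi, rfl⟩).1

theorem le_top (h : IsMaximalBranch S r P) {i : ℕ} (hi : i ≤ r) : P i ≤ P r :=
  ((h.mem_and_le_iff _).2 ⟨i, hi, rfl⟩).2

theorem le_iff (h : IsMaximalBranch S r P) {i j : ℕ} (hi : i ≤ r) (hj : j ≤ r) :
    P i ≤ P j ↔ i ≤ j :=
  h.strictMonoOn.le_iff_le hi hj

/-- Splitting a lower set into its parts on and off the branch. -/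
theorem card_lowerSubsets (h : IsMaximalBranch S r P) (hS : S.Finite) :
    Nat.card {L // L ∈ lowerSubsets S ∧ L.Nonempty} =
      ∑ V ∈ (finite_lowerSubsets (hS.subset (Set.sep_subset _ _) :
        (offBranch S r P).Finite)).toFinset, (cutoffs r P V).ncard := by
  have hUfin : (offBranch S r P).Finite := hS.subset (Set.sep_subset _ _)
  have hfin := finite_lowerSubsets hUfin
  have hoff : ∀ V ∈ lowerSubsets (offBranch S r P), ∀ i ≤ r, P i ∉ V := fun V hV i hi hmem =>
    (hV.1 hmem).2 (h.le_top hi)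
  let f : (Σ V : hfin.toFinset, cutoffs r P V.1) → {L // L ∈ lowerSubsets S ∧ L.Nonempty} :=
    fun p => ⟨p.1.1 ∪ P '' Set.Iic p.2.1, by
      obtain ⟨⟨V, hV⟩, j, hj⟩ := p
      rw [Set.Finite.mem_toFinset] at hV
      refine ⟨⟨?_, ?_⟩, P 0, Or.inr ⟨0, Nat.zero_le _, rfl⟩⟩
      · rintro x (hx | ⟨i, hi, rfl⟩)
        · exact (hV.1 hx).1
        · exact h.mem (le_trans hi hj.1)
      · rintro x (hx | ⟨i, hi, rfl⟩) y hy hyx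
        · by_cases hyr : y ≤ P r
          · obtain ⟨i, hi, rfl⟩ := (h.mem_and_le_iff y).1 ⟨hy, hyr⟩
            exact Or.inr ⟨i, hj.2 x hx i hi hyx, rfl⟩
          · exact Or.inl (hV.2 x hx y ⟨hy, hyr⟩ hyx)
        · have hir : i ≤ r := le_trans hi hj.1
          obtain ⟨k, hk, rfl⟩ := (h.mem_and_le_iff y).1 ⟨hy, hyx.trans (h.le_top hir)⟩
          exact Or.inr ⟨k, ((h.le_iff hk hir).1 hyx).trans hi, rfl⟩⟩
  have hf : Function.Bijective f := by
    constructor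
    · have hsub : ∀ V ∈ lowerSubsets (offBranch S r P), ∀ W ∈ lowerSubsets (offBranch S r P),
          ∀ j ≤ r, ∀ k ≤ r, V ∪ P '' Set.Iic j = W ∪ P '' Set.Iic k → V ⊆ W ∧ j ≤ k := by
        intro V hV W hW j hj k hk heq
        constructor
        · intro x hx
          rcases (heq ▸ Or.inl hx : x ∈ W ∪ P '' Set.Iic k) with hx' | ⟨i, hi, rfl⟩
          · exact hx'
          · exact absurd hx (hoff V hV i (le_trans hi hk))
        · rcases (heq ▸ Or.inr ⟨j, le_refl j, rfl⟩ : P j ∈ W ∪ P '' Set.Iic k) with hx' | ⟨i, hi, hij⟩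
          · exact absurd hx' (hoff W hW j hj)
          · exact h.strictMonoOn.injOn (le_trans hi hk) hj hij ▸ hi
      rintro ⟨⟨V, hV⟩, j, hj⟩ ⟨⟨W, hW⟩, k, hk⟩ heq
      have heq : V ∪ P '' Set.Iic j = W ∪ P '' Set.Iic k := congrArg Subtype.val heq
      have hV' := (Set.Finite.mem_toFinset hfin).1 hV
      have hW' := (Set.Finite.mem_toFinset hfin).1 hW
      obtain ⟨h1, h2⟩ := hsub V hV' W hW' j hj.1 k hk.1 heq
      obtain ⟨h3, h4⟩ := hsub W hW' V hV' k hk.1 j hj.1 heq.symm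
      obtain rfl := h1.antisymm h3
      obtain rfl := le_antisymm h2 h4
      rfl
    · classical
      rintro ⟨L, hL, x, hx⟩
      have h0 : P 0 ∈ L := hL.2 x hx _ (h.mem (Nat.zero_le r)) (h.bot_le x (hL.1 hx))
      set j := Nat.findGreatest (fun i => P i ∈ L) r with hj
      have hjr : j ≤ r := Nat.findGreatest_le r
      have hjL : P j ∈ L := Nat.findGreatest_spec (P := fun i => P i ∈ L) (Nat.zero_le r) h0
      refine ⟨⟨⟨{x ∈ L | ¬ x ≤ P r}, ?_⟩, j, hjr, ?_⟩, Subtype.ext ?_⟩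
      · rw [Set.Finite.mem_toFinset]
        exact ⟨fun y hy => ⟨hL.1 hy.1, hy.2⟩, fun y hy z hz hzy =>
          ⟨hL.2 y hy.1 z hz.1 hzy, hz.2⟩⟩
      · intro v hv i hi hiv
        exact Nat.le_findGreatest hi (hL.2 v hv.1 _ (h.mem hi) hiv)
      · change {x ∈ L | ¬ x ≤ P r} ∪ P '' Set.Iic j = L
        ext y
        constructor
        · rintro (hy | ⟨i, hi, rfl⟩)
          · exact hy.1
          · have hir : i ≤ r := le_trans hi hjr
            exact hL.2 _ hjL _ (h.mem hir) ((h.le_iff hir hjr).2 hi)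
        · intro hy
          by_cases hyr : y ≤ P r
          · obtain ⟨i, hi, rfl⟩ := (h.mem_and_le_iff y).1 ⟨hL.1 hy, hyr⟩
            exact Or.inr ⟨i, Nat.le_findGreatest hi hy, rfl⟩
          · exact Or.inl ⟨hy, hyr⟩
  rw [← Nat.card_congr (Equiv.ofBijective f hf)]
  have : ∀ V : hfin.toFinset, Finite (cutoffs r P V.1) := fun V => finite_cutoffs r P V.1
  rw [Nat.card_sigma]
  exact Finset.sum_coe_sort hfin.toFinset fun V => (cutoffs r P V).ncard

/-- The cutoffs of `V` form the interval from `f` to `r`, where `f` is the largest index of a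
branch element below a member of `V`. -/
theorem exists_cutoff (h : IsMaximalBranch S r P) {V : Set α} (hV : V ⊆ offBranch S r P)
    (hne : V.Nonempty) :
    ∃ f < r, (∃ v ∈ V, P f ≤ v) ∧ (∀ v ∈ V, ∀ i ≤ r, P i ≤ v → i ≤ f) ∧
      (cutoffs r P V).ncard + f = r + 1 := by
  classical
  obtain ⟨x, hx⟩ := hne
  set f := Nat.findGreatest (fun i => ∃ v ∈ V, P i ≤ v) r with hf
  have hfr : f ≤ r := Nat.findGreatest_le r
  have hspec : ∃ v ∈ V, P f ≤ v := Nat.findGreatest_spec (P := fun i => ∃ v ∈ V, P i ≤ v)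
    (Nat.zero_le r) ⟨x, hx, h.bot_le x (hV hx).1⟩
  have hle : ∀ v ∈ V, ∀ i ≤ r, P i ≤ v → i ≤ f := fun v hv i hi hiv =>
    Nat.le_findGreatest hi ⟨v, hv, hiv⟩
  obtain ⟨v, hv, hfv⟩ := hspec
  refine ⟨f, lt_of_le_of_ne hfr fun heq => ?_, ⟨v, hv, hfv⟩, hle, ?_⟩
  · rw [heq] at hfv
    exact (hV hv).2 (h.eq_of_le v (hV hv).1 hfv).le
  · have : cutoffs r P V = ↑(Finset.Icc f r) := by
      ext j
      rw [Finset.coe_Icc, Set.mem_Icc]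
      exact ⟨fun hj => ⟨hj.2 v hv f hfr hfv, hj.1⟩, fun hj =>
        ⟨hj.2, fun w hw i hi hiw => (hle w hw i hi hiw).trans hj.1⟩⟩
    rw [this, Set.ncard_coe_finset, Nat.card_Icc]
    omega

end IsMaximalBranch

/-! ### The posets with `7 + r` nonempty lower sets -/

/-- Three terms, each at least `2`, exhaust a sum equal to `6`. -/
theorem eq_of_sum_eq_six {ι : Type*} {T : Finset ι} {c : ι → ℕ} (hc : ∀ i ∈ T, 2 ≤ c i)
    (hsum : ∑ i ∈ T, c i = 6) {i j k : ι} (hi : i ∈ T) (hj : j ∈ T) (hk : k ∈ T) (hij : i ≠ j)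
    (hik : i ≠ k) (hjk : j ≠ k) :
    (∀ l ∈ T, l = i ∨ l = j ∨ l = k) ∧ c i = 2 ∧ c j = 2 ∧ c k = 2 := by
  classical
  have h1 := Finset.add_sum_erase T c hi
  have h2 := Finset.add_sum_erase (T.erase i) c (Finset.mem_erase.2 ⟨hij.symm, hj⟩)
  have h3 := Finset.add_sum_erase ((T.erase i).erase j) c
    (Finset.mem_erase.2 ⟨hjk.symm, Finset.mem_erase.2 ⟨hik.symm, hk⟩⟩)
  have hci := hc i hi
  have hcj := hc j hj
  have hck := hc k hk
  refine ⟨fun l hl => ?_, by omega, by omega, by omega⟩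
  by_contra! hne
  have h4 := Finset.add_sum_erase (((T.erase i).erase j).erase k) c (a := l) (by
    simp only [Finset.mem_erase]
    exact ⟨hne.2.2, hne.2.1, hne.1, hl⟩)
  have hcl := hc l hl
  omega

namespace IsMaximalBranch

variable {α : Type*} [PartialOrder α] {S : Set α} {r : ℕ} {P : ℕ → α}

theorem card_lowerSubsets_eq_iff (h : IsMaximalBranch S r P) (hS : S.Finite)
    {T : Finset (Set α)} (hT : ∀ V, V ∈ T ↔ V ∈ lowerSubsets (offBranch S r P) ∧ V.Nonempty) :
    Nat.card {L // L ∈ lowerSubsets S ∧ L.Nonempty} = 7 + r ↔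
      ∑ V ∈ T, (cutoffs r P V).ncard = 6 := by
  classical
  have hfin := finite_lowerSubsets (hS.subset (Set.sep_subset _ _) : (offBranch S r P).Finite)
  have hT' : T = hfin.toFinset.erase ∅ := by
    ext V
    rw [hT, Finset.mem_erase, Set.Finite.mem_toFinset, Set.nonempty_iff_ne_empty, and_comm]
  have hsum := Finset.add_sum_erase hfin.toFinset (fun V => (cutoffs r P V).ncard)
    (hfin.mem_toFinset.2 (empty_mem_lowerSubsets _))
  rw [h.card_lowerSubsets hS, hT', ← hsum, ncard_cutoffs_empty]
  omega

/-- The cutoffs of `V` number `r + 1 - k` when `P k` is the last branch element below a member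
of `V`. -/
theorem ncard_cutoffs_add (h : IsMaximalBranch S r P) {V : Set α} (hV : V ⊆ offBranch S r P)
    {k : ℕ} (hk : k < r) {v : α} (hv : v ∈ V) (hkv : P k ≤ v) (hlast : ∀ w ∈ V, ¬ P (k + 1) ≤ w) :
    (cutoffs r P V).ncard + k = r + 1 := by
  obtain ⟨f, hfr, ⟨w, hw, hfw⟩, hle, hc⟩ := h.exists_cutoff hV ⟨v, hv⟩
  have h1 := hle v hv k hk.le hkv
  have h2 : ¬ k + 1 ≤ f := fun hkf =>
    hlast w hw (((h.le_iff (by omega) hfr.le).2 hkf).trans hfw)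
  omega

/-- Conversely, the number of cutoffs of `V` determines the last branch element below a member
of `V`. -/
theorem lt_and_le_of_ncard_cutoffs_add (h : IsMaximalBranch S r P) {V : Set α}
    (hV : V ⊆ offBranch S r P) (hne : V.Nonempty) {k : ℕ}
    (hk : (cutoffs r P V).ncard + k = r + 1) :
    k < r ∧ (∃ v ∈ V, P k ≤ v) ∧ ∀ v ∈ V, ¬ P (k + 1) ≤ v := by
  obtain ⟨f, hfr, hex, hle, hc⟩ := h.exists_cutoff hV hne
  obtain rfl : f = k := by omega
  refine ⟨hfr, hex, fun v hv hfv => ?_⟩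
  have := hle v hv (f + 1) hfr hfv
  omega

theorem two_le_ncard_cutoffs (h : IsMaximalBranch S r P) {V : Set α}
    (hV : V ⊆ offBranch S r P) (hne : V.Nonempty) : 2 ≤ (cutoffs r P V).ncard := by
  obtain ⟨f, hfr, -, -, hc⟩ := h.exists_cutoff hV hne
  omega

/-- In a forest, the branch elements below `b` are already below every `a ≤ b` off the branch. -/
theorem le_of_le_offBranch (h : IsMaximalBranch S r P)
    (hforest : ∀ m ∈ S, ∀ x ∈ S, ∀ y ∈ S, x ≤ m → y ≤ m → x ≤ y ∨ y ≤ x) {a b : α}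
    (ha : a ∈ offBranch S r P) (hb : b ∈ offBranch S r P) (hab : a ≤ b) {i : ℕ} (hi : i ≤ r)
    (hib : P i ≤ b) : P i ≤ a :=
  (hforest b hb.1 _ (h.mem hi) a ha.1 hib hab).resolve_right fun hai =>
    ha.2 (hai.trans (h.le_top hi))

/-- The three shapes of the part off the branch for which the sum is `6`: two incomparable elements
(`2 + 2 + 2`), a single element (`6`), or a chain of two elements (`3 + 3`). -/
theorem sum_eq_six_iff (h : IsMaximalBranch S r P)
    (hforest : ∀ m ∈ S, ∀ x ∈ S, ∀ y ∈ S, x ≤ m → y ≤ m → x ≤ y ∨ y ≤ x)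
    (hdim : ∀ u ∈ offBranch S r P, ∀ v ∈ offBranch S r P, u < v → ¬ P (r - 1) ≤ u)
    {T : Finset (Set α)} (hT : ∀ V, V ∈ T ↔ V ∈ lowerSubsets (offBranch S r P) ∧ V.Nonempty) :
    ∑ V ∈ T, (cutoffs r P V).ncard = 6 ↔
      (1 ≤ r ∧ ∃ u v, ¬ u ≤ v ∧ ¬ v ≤ u ∧ offBranch S r P = {u, v} ∧ P (r - 1) ≤ u ∧
        P (r - 1) ≤ v) ∨
      (5 ≤ r ∧ ∃ u, offBranch S r P = {u} ∧ P (r - 5) ≤ u ∧ ¬ P (r - 4) ≤ u) ∨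
      (2 ≤ r ∧ ∃ u v, u < v ∧ offBranch S r P = {u, v} ∧ P (r - 2) ≤ u) := by
  classical
  set U := offBranch S r P with hU
  have hsub : ∀ V ∈ T, V ⊆ U := fun V hV => ((hT V).1 hV).1.1
  have hc2 : ∀ V ∈ T, 2 ≤ (cutoffs r P V).ncard := fun V hV =>
    h.two_le_ncard_cutoffs (hsub V hV) ((hT V).1 hV).2
  have hprin : ∀ u ∈ U, {w ∈ U | w ≤ u} ∈ T := fun u hu =>
    (hT _).2 ⟨principal_mem_lowerSubsets U u, u, hu, le_rfl⟩
  have hlast : ∀ w ∈ U, ¬ P r ≤ w := fun w hw hrw => hw.2 (h.eq_of_le w hw.1 hrw).le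
  -- if `V` has only two cutoffs, then `P (r - 1)` lies below a member of `V`
  have hc_two : ∀ V ∈ T, (cutoffs r P V).ncard = 2 → 1 ≤ r ∧ ∃ v ∈ V, P (r - 1) ≤ v := by
    intro V hV hc
    obtain ⟨f, hfr, hex, -, hf⟩ := h.exists_cutoff (hsub V hV) ((hT V).1 hV).2
    obtain rfl : f = r - 1 := by omega
    exact ⟨by omega, hex⟩
  constructor
  · intro hsum
    by_cases hchain : ∀ u ∈ U, ∀ v ∈ U, u ≤ v ∨ v ≤ u
    · right
      obtain ⟨a, ha⟩ : U.Nonempty := by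
        by_contra hne
        have : T = ∅ := Finset.eq_empty_of_forall_notMem fun V hV =>
          hne (((hT V).1 hV).2.mono (hsub V hV))
        simp [this] at hsum
      by_cases hone : ∀ b ∈ U, b = a
      · left
        have hUa : U = {a} := Set.eq_singleton_iff_unique_mem.2 ⟨ha, hone⟩
        have hTa : T = {{a}} := by
          ext V
          rw [hT, hUa, Finset.mem_singleton]
          constructor
          · rintro ⟨hV, hne⟩
            exact (Set.subset_singleton_iff_eq.1 hV.1).resolve_left hne.ne_empty
          · rintro rfl
            exact ⟨⟨subset_rfl, fun _ _ _ hy _ => hy⟩, Set.singleton_nonempty a⟩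
        rw [hTa, Finset.sum_singleton] at hsum
        obtain ⟨f, hfr, -, -, hf⟩ := h.exists_cutoff (Set.singleton_subset_iff.2 ha)
          (Set.singleton_nonempty a)
        obtain ⟨-, ⟨w, hw, hv⟩, hlast⟩ := h.lt_and_le_of_ncard_cutoffs_add
          (Set.singleton_subset_iff.2 ha) (Set.singleton_nonempty a) (k := r - 5) (by omega)
        rw [Set.mem_singleton_iff.1 hw] at hv
        refine ⟨by omega, a, hUa, hv, ?_⟩
        have := hlast _ rfl
        rwa [show r - 5 + 1 = r - 4 by omega] at this
      · right
        obtain ⟨a, ha, b, hb, hab⟩ : ∃ a ∈ U, ∃ b ∈ U, a < b := by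
          push Not at hone
          obtain ⟨b, hb, hne⟩ := hone
          rcases hchain a ha b hb with hab | hab
          · exact ⟨a, ha, b, hb, lt_of_le_of_ne hab hne.symm⟩
          · exact ⟨b, hb, a, ha, lt_of_le_of_ne hab hne⟩
        have hUab : U = {a, b} := by
          refine Set.Subset.antisymm (fun w hw => ?_) (by
            rintro x (rfl | rfl)
            · exact ha
            · exact hb)
          by_contra hne
          rw [Set.mem_insert_iff, Set.mem_singleton_iff, not_or] at hne
          -- a third element would give three principal lower sets with two cutoffs each
          have hca := (eq_of_sum_eq_six hc2 hsum (hprin a ha) (hprin b hb) (hprin w hw)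
            (fun he => hab.ne (principal_injOn ha hb he))
            (fun he => hne.1 (principal_injOn ha hw he).symm)
            (fun he => hne.2 (principal_injOn hb hw he).symm)).2.1
          obtain ⟨-, v, hv, hrv⟩ := hc_two _ (hprin a ha) hca
          exact hdim a ha b hb hab (hrv.trans hv.2)
        have hTab : T = {{a}, {a, b}} := by
          ext V
          rw [hT, hUab, Finset.mem_insert, Finset.mem_singleton]
          constructor
          · rintro ⟨hV, hne⟩
            rcases Set.subset_pair_iff_eq.1 hV.1 with rfl | rfl | rfl | rfl
            · exact absurd rfl hne.ne_empty
            · exact Or.inl rfl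
            · exact absurd (hV.2 b rfl a (by simp) hab.le) hab.ne
            · exact Or.inr rfl
          · rintro (rfl | rfl)
            · refine ⟨⟨by simp, ?_⟩, Set.singleton_nonempty _⟩
              rintro _ rfl y (rfl | rfl) hy
              · rfl
              · exact absurd hy hab.not_ge
            · exact ⟨⟨subset_rfl, fun _ _ _ hy _ => hy⟩, a, by simp⟩
        have hne : ({a} : Set α) ≠ {a, b} := fun he =>
          hab.ne' (he ▸ (by simp : b ∈ ({a, b} : Set α)) : b ∈ ({a} : Set α))
        rw [hTab, Finset.sum_pair hne] at hsum
        have hsub1 : {a} ⊆ U := Set.singleton_subset_iff.2 ha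
        obtain ⟨f, hfr, ⟨w, hw, hfa⟩, hle, hf⟩ := h.exists_cutoff hsub1 (Set.singleton_nonempty _)
        rw [Set.mem_singleton_iff.1 hw] at hfa
        have hf2 : (cutoffs r P {a, b}).ncard + f = r + 1 := by
          refine h.ncard_cutoffs_add hUab.ge hfr (v := a) (by simp) hfa ?_
          have hfa' : ¬ P (f + 1) ≤ a := fun hfa' => by
            have := hle a rfl (f + 1) hfr hfa'
            omega
          rintro w (rfl | rfl) hw
          · exact hfa' hw
          · exact hfa' (h.le_of_le_offBranch hforest ha hb hab.le hfr hw)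
        obtain rfl : f = r - 2 := by omega
        exact ⟨by omega, a, b, hab, hUab, hfa⟩
    · left
      push Not at hchain
      obtain ⟨u, hu, v, hv, huv, hvu⟩ := hchain
      have hunion : {w ∈ U | w ≤ u} ∪ {w ∈ U | w ≤ v} ∈ T :=
        (hT _).2 ⟨union_mem_lowerSubsets (principal_mem_lowerSubsets U u)
          (principal_mem_lowerSubsets U v), u, Or.inl ⟨hu, le_rfl⟩⟩
      have hv1 : v ∈ {w ∈ U | w ≤ u} ∪ {w ∈ U | w ≤ v} := Or.inr ⟨hv, le_rfl⟩
      have hu1 : u ∈ {w ∈ U | w ≤ u} ∪ {w ∈ U | w ≤ v} := Or.inl ⟨hu, le_rfl⟩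
      obtain ⟨hall, hcu, hcv, -⟩ := eq_of_sum_eq_six hc2 hsum (hprin u hu) (hprin v hv) hunion
        (fun he => huv (principal_injOn hu hv he).le)
        (fun he => hvu (he ▸ hv1 : v ∈ {w ∈ U | w ≤ u}).2)
        (fun he => huv (he ▸ hu1 : u ∈ {w ∈ U | w ≤ v}).2)
      obtain ⟨hr, x, hx, hrx⟩ := hc_two _ (hprin u hu) hcu
      obtain ⟨-, y, hy, hry⟩ := hc_two _ (hprin v hv) hcv
      refine ⟨hr, u, v, huv, hvu, Set.Subset.antisymm (fun w hw => ?_) (by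
        rintro x (rfl | rfl)
        · exact hu
        · exact hv), hrx.trans hx.2, hry.trans hy.2⟩
      rcases hall _ (hprin w hw) with he | he | he
      · exact Or.inl (principal_injOn hw hu he)
      · exact Or.inr (principal_injOn hw hv he)
      · -- `u` and `v` would both lie below `w`, hence be comparable
        have h1 := (he.symm ▸ hu1 : u ∈ {x ∈ U | x ≤ w}).2
        have h2 := (he.symm ▸ hv1 : v ∈ {x ∈ U | x ≤ w}).2
        exact ((hforest w hw.1 u hu.1 v hv.1 h1 h2).elim huv hvu).elim
  · rintro (⟨hr, u, v, huv, hvu, hUuv, hru, hrv⟩ | ⟨hr, u, hUu, hru, hru'⟩ |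
      ⟨hr, u, v, huv, hUuv, hru⟩)
    · have hu : u ∈ U := hUuv ▸ (by simp)
      have hv : v ∈ U := hUuv ▸ (by simp)
      have hT3 : T = {{u}, {v}, {u, v}} := by
        ext V
        rw [hT, hUuv, Finset.mem_insert, Finset.mem_insert, Finset.mem_singleton]
        constructor
        · rintro ⟨hV, hne⟩
          exact (Set.subset_pair_iff_eq.1 hV.1).resolve_left hne.ne_empty
        · rintro (rfl | rfl | rfl)
          · refine ⟨⟨by simp, ?_⟩, Set.singleton_nonempty _⟩
            rintro _ rfl y (rfl | rfl) hy
            · rfl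
            · exact absurd hy hvu
          · refine ⟨⟨by simp, ?_⟩, Set.singleton_nonempty _⟩
            rintro _ rfl y (rfl | rfl) hy
            · exact absurd hy huv
            · rfl
          · exact ⟨⟨subset_rfl, fun _ _ _ hy _ => hy⟩, u, by simp⟩
      have hne : u ≠ v := fun he => huv he.le
      have hcount : ∀ V ⊆ U, ∀ w ∈ V, P (r - 1) ≤ w → (cutoffs r P V).ncard = 2 := by
        intro V hV w hw hrw
        have := h.ncard_cutoffs_add hV (k := r - 1) (by omega) hw hrw (fun x hx => by
          rw [Nat.sub_add_cancel hr]
          exact hlast x (hV hx))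
        omega
      have hn1 : ({u} : Set α) ≠ {u, v} := fun he =>
        hne ((he ▸ (by simp : v ∈ ({u, v} : Set α)) : v ∈ ({u} : Set α))).symm
      have hn2 : ({v} : Set α) ≠ {u, v} := fun he =>
        hne ((he ▸ (by simp : u ∈ ({u, v} : Set α)) : u ∈ ({v} : Set α)))
      rw [hT3, Finset.sum_insert (by simp [hne, hn1]), Finset.sum_pair hn2,
        hcount {u} (Set.singleton_subset_iff.2 hu) u rfl hru,
        hcount {v} (Set.singleton_subset_iff.2 hv) v rfl hrv,
        hcount {u, v} hUuv.ge u (by simp) hru]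
      norm_num
    · have hTu : T = {{u}} := by
        ext V
        rw [hT, hUu, Finset.mem_singleton]
        constructor
        · rintro ⟨hV, hne⟩
          exact (Set.subset_singleton_iff_eq.1 hV.1).resolve_left hne.ne_empty
        · rintro rfl
          exact ⟨⟨subset_rfl, fun _ _ _ hy _ => hy⟩, Set.singleton_nonempty u⟩
      have := h.ncard_cutoffs_add hUu.ge (k := r - 5) (by omega) (Set.mem_singleton u) hru
        (by
          rintro _ rfl
          rwa [show r - 5 + 1 = r - 4 by omega])
      rw [hTu, Finset.sum_singleton]
      omega
    · have hu : u ∈ U := hUuv ▸ (by simp)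
      have hv : v ∈ U := hUuv ▸ (by simp)
      have hTuv : T = {{u}, {u, v}} := by
        ext V
        rw [hT, hUuv, Finset.mem_insert, Finset.mem_singleton]
        constructor
        · rintro ⟨hV, hne⟩
          rcases Set.subset_pair_iff_eq.1 hV.1 with rfl | rfl | rfl | rfl
          · exact absurd rfl hne.ne_empty
          · exact Or.inl rfl
          · exact absurd (hV.2 v rfl u (by simp) huv.le) huv.ne
          · exact Or.inr rfl
        · rintro (rfl | rfl)
          · refine ⟨⟨by simp, ?_⟩, Set.singleton_nonempty _⟩
            rintro _ rfl y (rfl | rfl) hy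
            · rfl
            · exact absurd hy huv.not_ge
          · exact ⟨⟨subset_rfl, fun _ _ _ hy _ => hy⟩, u, by simp⟩
      have hcount : ∀ V ⊆ U, u ∈ V → (cutoffs r P V).ncard = 3 := by
        intro V hV huV
        have := h.ncard_cutoffs_add hV (k := r - 2) (by omega) huV hru (fun x hx hrx => by
          rw [show r - 2 + 1 = r - 1 by omega] at hrx
          refine hdim u hu v hv huv ?_
          rcases (hUuv ▸ hV hx : x ∈ ({u, v} : Set α)) with rfl | rfl
          · exact hrx
          · exact h.le_of_le_offBranch hforest hu hv huv.le (by omega) hrx)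
        omega
      have hn : ({u} : Set α) ≠ {u, v} := fun he =>
        huv.ne' (he ▸ (by simp : v ∈ ({u, v} : Set α)) : v ∈ ({u} : Set α))
      rw [hTuv, Finset.sum_pair hn, hcount {u} (Set.singleton_subset_iff.2 hu) rfl,
        hcount {u, v} hUuv.ge (by simp)]

end IsMaximalBranch

/-! ### Chains of primes of maximal length -/

/-- A strictly increasing sequence of primes `Q 0 < ⋯ < Q n` has `n ≤ dim R`. -/
theorem le_of_strictMonoOn_isPrime {R : Type*} [CommRing R] {r n : ℕ} (hr : ringKrullDim R = r)
    (Q : ℕ → Ideal R) (hQ : StrictMonoOn Q (Set.Iic n)) (hp : ∀ i ≤ n, (Q i).IsPrime) : n ≤ r := by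
  let l : LTSeries (PrimeSpectrum R) := LTSeries.mk n
    (fun i : Fin (n + 1) => ⟨Q i, hp i (Nat.lt_succ_iff.1 i.2)⟩) fun i j hij =>
      hQ (Nat.lt_succ_iff.1 i.2) (Nat.lt_succ_iff.1 j.2) hij
  have h := Order.LTSeries.length_le_krullDim l
  change (n : WithBot ℕ∞) ≤ ringKrullDim R at h
  rw [hr] at h
  exact_mod_cast h

/-- If primes form a forest, a chain of primes of maximal length is everything below its top:
on a prime below the top, the height agrees with the index in the chain. -/
theorem exists_isMaximalBranch {R : Type*} [CommRing R] [IsDomain R] {r : ℕ}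
    (hr : ringKrullDim R = r) (hR : IsLocallyValuation R) :
    ∃ P : ℕ → Ideal R, IsMaximalBranch {I : Ideal R | I.IsPrime} r P := by
  obtain ⟨l, rfl⟩ := Order.le_krullDim_iff.1 (hr.ge : (r : WithBot ℕ∞) ≤ Order.krullDim _)
  have hle : ∀ x : PrimeSpectrum R, Order.height x ≤ l.length := fun x => by
    have h := Order.height_le_krullDim x
    rw [show Order.krullDim (PrimeSpectrum R) = _ from hr] at h
    exact_mod_cast h
  have hfin : ∀ x : PrimeSpectrum R, Order.height x < ⊤ := fun x =>
    (hle x).trans_lt (ENat.natCast_lt_top _)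
  have hidx := Order.height_eq_index_of_length_eq_height_last
    (le_antisymm Order.length_le_height_last (hle l.last))
  have hlast : l (Fin.last _) = l.last := rfl
  have hbelow : ∀ x ≤ l.last, ∃ i, l i = x := by
    intro x hx
    obtain ⟨k, hk⟩ := ENat.ne_top_iff_exists.1 (hfin x).ne
    have hkl : k < l.length + 1 := by
      have := hle x
      rw [← hk] at this
      exact Nat.lt_succ_iff.2 (by exact_mod_cast this)
    have hheight : Order.height (l ⟨k, hkl⟩) = Order.height x := by rw [hidx, ← hk]
    have hcomp : l ⟨k, hkl⟩ ≤ x ∨ x ≤ l ⟨k, hkl⟩ := hR.le_or_le (l ⟨k, hkl⟩).2 x.2 l.last.2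
      (hlast ▸ l.monotone (Fin.le_last _)) hx
    refine ⟨⟨k, hkl⟩, ?_⟩
    rcases hcomp with h | h
    · exact h.eq_of_not_lt fun hlt => (Order.height_strictMono hlt (hfin _)).ne hheight
    · exact (h.eq_of_not_lt fun hlt => (Order.height_strictMono hlt (hfin _)).ne' hheight).symm
  let P : ℕ → Ideal R := fun i => if h : i < l.length + 1 then (l ⟨i, h⟩).asIdeal else ⊥
  have hP : ∀ (i : ℕ) (h : i < l.length + 1), P i = (l ⟨i, h⟩).asIdeal := fun i h => dif_pos h
  have hPr : P l.length = l.last.asIdeal := hP _ (Nat.lt_succ_self _)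
  refine ⟨P, ?_, ?_, ?_, ?_⟩
  · intro i hi j hj hij
    rw [hP i (Nat.lt_succ_iff.2 hi), hP j (Nat.lt_succ_iff.2 hj)]
    exact l.strictMono (show (⟨i, _⟩ : Fin (l.length + 1)) < ⟨j, _⟩ from hij)
  · intro x
    rw [hPr]
    constructor
    · rintro ⟨hx, hxl⟩
      obtain ⟨i, hi⟩ := hbelow ⟨x, hx⟩ hxl
      exact ⟨i, Nat.lt_succ_iff.1 i.2, by rw [hP i i.2, hi]⟩
    · rintro ⟨i, hi, rfl⟩
      rw [hP i (Nat.lt_succ_iff.2 hi)]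
      exact ⟨(l _).2, l.monotone (Fin.le_last _)⟩
  · intro x _
    obtain ⟨i, hi⟩ := hbelow ⟨⊥, Ideal.isPrime_bot⟩
      (bot_le : (⊥ : Ideal R) ≤ l.last.asIdeal)
    have h0 : P 0 ≤ ⊥ := by
      rw [hP 0 (Nat.succ_pos _), show (⊥ : Ideal R) = (l i).asIdeal by rw [hi]]
      exact l.monotone (Fin.zero_le i)
    exact h0.trans bot_le
  · intro x hx hPx
    rw [hPr] at hPx ⊢
    by_contra hne
    have hlt : l.last < ⟨x, hx⟩ := lt_of_le_of_ne hPx fun h => hne (congrArg PrimeSpectrum.asIdeal h).symm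
    have h1 := Order.height_strictMono hlt (hfin _)
    rw [← hlast, hidx] at h1
    exact h1.not_ge (hle _)

theorem isMaximal_of_forall_isPrime {R : Type*} [CommRing R] {M : Ideal R} (hM : M.IsPrime)
    (h : ∀ Q : Ideal R, Q.IsPrime → M ≤ Q → Q = M) : M.IsMaximal := by
  obtain ⟨Q, hQ, hMQ⟩ := M.exists_le_maximal hM.ne_top
  exact h Q hQ.isPrime hMQ ▸ hQ

/-- A prime above `P (r - 1)` and off the branch is not properly contained in another prime: the
chain would be longer than `dim R`. -/
theorem IsMaximalBranch.not_le_of_lt {R : Type*} [CommRing R] {r : ℕ} (hr : ringKrullDim R = r)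
    {P : ℕ → Ideal R} (hP : IsMaximalBranch {I : Ideal R | I.IsPrime} r P) :
    ∀ u ∈ offBranch {I : Ideal R | I.IsPrime} r P,
      ∀ v ∈ offBranch {I : Ideal R | I.IsPrime} r P, u < v → ¬ P (r - 1) ≤ u := by
  intro u hu v hv huv hle
  have hltu : ∀ i < r, P i < u := by
    intro i hi
    refine lt_of_le_of_ne (le_trans ((hP.le_iff hi.le (by omega)).2 (by omega)) hle) ?_
    rintro rfl
    exact hu.2 (hP.le_top hi.le)
  have := le_of_strictMonoOn_isPrime (n := r + 1) hr
    (fun i => if i < r then P i else if i = r then u else v) ?_ ?_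
  · omega
  · intro i hi j hj hij
    simp only [Set.mem_Iic] at hi hj ⊢
    by_cases hjr : j < r
    · rw [if_pos hjr, if_pos (hij.trans hjr)]
      exact hP.strictMonoOn (hij.trans hjr).le hjr.le hij
    · rw [if_neg hjr]
      by_cases hir : i < r
      · rw [if_pos hir]
        split_ifs
        · exact hltu i hir
        · exact (hltu i hir).trans huv
      · rw [if_neg hir, if_pos (by omega), if_neg (by omega)]
        exact huv
  · intro i hi
    split_ifs with h1 h2
    · exact hP.mem h1.le
    · exact hu.1
    · exact hv.1

/-! ### The characterization -/

theorem IsLocallyValuation.card_subalgebra_eq_iff {R K : Type*} [CommRing R] [IsDomain R] [Field K]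
    [Algebra R K] [IsFractionRing R K] (hR : IsLocallyValuation R) {r : ℕ}
    (hr : ringKrullDim R = r) (hfin : {I : Ideal R | I.IsPrime}.Finite) {P : ℕ → Ideal R}
    (hP : IsMaximalBranch {I : Ideal R | I.IsPrime} r P) :
    ENat.card (Subalgebra R K) = 7 + r ↔
      (1 ≤ r ∧ ∃ u v, ¬ u ≤ v ∧ ¬ v ≤ u ∧ offBranch {I : Ideal R | I.IsPrime} r P = {u, v} ∧
        P (r - 1) ≤ u ∧ P (r - 1) ≤ v) ∨
      (5 ≤ r ∧ ∃ u, offBranch {I : Ideal R | I.IsPrime} r P = {u} ∧ P (r - 5) ≤ u ∧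
        ¬ P (r - 4) ≤ u) ∨
      (2 ≤ r ∧ ∃ u v, u < v ∧ offBranch {I : Ideal R | I.IsPrime} r P = {u, v} ∧
        P (r - 2) ≤ u) := by
  classical
  have hlow := finite_lowerSubsets (hfin.subset (Set.sep_subset _ _) :
    (offBranch {I : Ideal R | I.IsPrime} r P).Finite)
  have hT : ∀ V, V ∈ hlow.toFinset.filter Set.Nonempty ↔
      V ∈ lowerSubsets (offBranch {I : Ideal R | I.IsPrime} r P) ∧ V.Nonempty := by simp
  have hfinL : Finite {L // L ∈ lowerSubsets {I : Ideal R | I.IsPrime} ∧ L.Nonempty} :=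
    ((finite_lowerSubsets hfin).subset (Set.sep_subset _ _)).to_subtype
  rw [← hP.sum_eq_six_iff (fun m hm x hx y hy hxm hym => hR.le_or_le hx hy hm hxm hym)
    (hP.not_le_of_lt hr) hT, ← hP.card_lowerSubsets_eq_iff hfin hT, hR.card_subalgebra hfin,
    ENat.card_eq_coe_natCard]
  exact_mod_cast Iff.rfl

theorem IsMaximalBranch.isMaximal_iff {R : Type*} [CommRing R] {r : ℕ} {P : ℕ → Ideal R}
    (hP : IsMaximalBranch {I : Ideal R | I.IsPrime} r P) (I : Ideal R) :
    I.IsMaximal ↔ I = P r ∨ (I ∈ offBranch {I : Ideal R | I.IsPrime} r P ∧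
      ∀ J ∈ offBranch {I : Ideal R | I.IsPrime} r P, I ≤ J → J = I) := by
  constructor
  · intro hI
    by_cases hle : I ≤ P r
    · exact Or.inl (hI.eq_of_le (hP.mem le_rfl).ne_top hle)
    · exact Or.inr ⟨⟨hI.isPrime, hle⟩, fun J hJ hIJ => (hI.eq_of_le hJ.1.ne_top hIJ).symm⟩
  · rintro (rfl | ⟨hI, h⟩)
    · exact isMaximal_of_forall_isPrime (hP.mem le_rfl) fun Q hQ hle => hP.eq_of_le Q hQ hle
    · exact isMaximal_of_forall_isPrime hI.1 fun Q hQ hle =>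
        h Q ⟨hQ, fun hQr => hI.2 (hle.trans hQr)⟩ hle

theorem IsMaximalBranch.isPrime_iff {R : Type*} [CommRing R] {r : ℕ} {P : ℕ → Ideal R}
    (hP : IsMaximalBranch {I : Ideal R | I.IsPrime} r P) (I : Ideal R) :
    I.IsPrime ↔ (∃ i ≤ r, P i = I) ∨ I ∈ offBranch {I : Ideal R | I.IsPrime} r P := by
  constructor
  · intro hI
    by_cases hle : I ≤ P r
    · exact Or.inl ((hP.mem_and_le_iff I).1 ⟨hI, hle⟩)
    · exact Or.inr ⟨hI, hle⟩
  · rintro (⟨i, hi, rfl⟩ | hI)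
    · exact hP.mem hi
    · exact hI.1

theorem IsMaximalBranch.lt_of_le {α : Type*} [PartialOrder α] {S : Set α} {r : ℕ} {P : ℕ → α}
    (hP : IsMaximalBranch S r P) {i : ℕ} (hi : i ≤ r) {u : α} (hu : u ∈ offBranch S r P)
    (hle : P i ≤ u) : P i < u :=
  lt_of_le_of_ne hle <| by
    rintro rfl
    exact hu.2 (hP.le_top hi)

/-- A chain of primes of length `dim R` cannot be refined. -/
theorem not_lt_of_lt_of_ringKrullDim_eq {R : Type*} [CommRing R] {r : ℕ} (hr : ringKrullDim R = r)
    {P : ℕ → Ideal R} (hmono : StrictMonoOn P (Set.Iic r)) (hp : ∀ i ≤ r, (P i).IsPrime)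
    {Q : Ideal R} (hQ : Q.IsPrime) {k : ℕ} (hk : k + 1 ≤ r) (h1 : P k < Q) : ¬ Q < P (k + 1) := by
  intro h2
  have := le_of_strictMonoOn_isPrime (n := r + 1) hr
    (fun i => if i ≤ k then P i else if i = k + 1 then Q else P (i - 1)) ?_ ?_
  · omega
  · intro i hi j hj hij
    simp only [Set.mem_Iic] at hi hj ⊢
    have hle : ∀ a b, a ≤ b → b ≤ r → P a ≤ P b := fun a b hab hb =>
      (hmono.le_iff_le (Set.mem_Iic.2 (hab.trans hb)) (Set.mem_Iic.2 hb)).2 hab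
    split_ifs
    · exact hmono (Set.mem_Iic.2 (by omega)) (Set.mem_Iic.2 (by omega)) hij
    · exact (hle i k (by omega) (by omega)).trans_lt h1
    · exact hmono (Set.mem_Iic.2 (by omega)) (Set.mem_Iic.2 (by omega)) (by omega)
    all_goals first
      | omega
      | exact h2.trans_le (hle (k + 1) (j - 1) (by omega) (by omega))
      | exact hmono (Set.mem_Iic.2 (by omega)) (Set.mem_Iic.2 (by omega)) (by omega)
  · intro i hi
    split_ifs
    · exact hp _ (by omega)
    · exact hQ
    · exact hp _ (by omega)

theorem isMaximalBranch_of_isMaximal {R : Type*} [CommRing R] {r : ℕ} {P : ℕ → Ideal R}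
    (h0 : P 0 = ⊥) (hmono : StrictMonoOn P (Set.Iic r)) (hp : ∀ i ≤ r, (P i).IsPrime)
    (hmax : (P r).IsMaximal) (hbelow : ∀ I : Ideal R, I.IsPrime → I ≤ P r → ∃ i ≤ r, P i = I) :
    IsMaximalBranch {I : Ideal R | I.IsPrime} r P where
  strictMonoOn := hmono
  mem_and_le_iff I := by
    constructor
    · rintro ⟨hI, hle⟩
      exact hbelow I hI hle
    · rintro ⟨i, hi, rfl⟩
      exact ⟨hp i hi, (hmono.le_iff_le (Set.mem_Iic.2 hi) (Set.mem_Iic.2 le_rfl)).2 hi⟩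
  bot_le I _ := h0 ▸ bot_le
  eq_of_le I hI hle := (hmax.eq_of_le hI.ne_top hle).symm

/-- `K` is the quotient field of `R`; the overrings of `R` are the subrings of `K` that contain
`R`, that is, the `R`-subalgebras of `K`. -/
theorem theorem2p9 {R K : Type*} [CommRing R] [IsDomain R] [IsIntegrallyClosed R]
    [Field K] [Algebra R K] [IsFractionRing R K] (r : ℕ) (hr : ringKrullDim R = r) :
    List.TFAE [
      -- (i)
      ENat.card (Subalgebra R K) = 7 + r,
      -- (ii)
      ENat.card {s : SemistarOperation R K // s.IsFiniteCharacter} = 7 + r,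
      -- (iii)
      IsPruferDomain R ∧
        ( -- (a)
          (1 ≤ r ∧ ∃ (P : ℕ → Ideal R) (M₁ M₂ M₃ : Ideal R),
            M₁ ≠ M₂ ∧ M₁ ≠ M₃ ∧ M₂ ≠ M₃ ∧
            {I : Ideal R | I.IsMaximal} = {M₁, M₂, M₃} ∧
            {I : Ideal R | I.IsPrime} = P '' Set.Iic (r - 1) ∪ {M₁, M₂, M₃} ∧
            P 0 = ⊥ ∧ StrictMonoOn P (Set.Iic (r - 1)) ∧
            P (r - 1) < M₁ ⊓ M₂ ⊓ M₃) ∨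
          -- (b)
          (5 ≤ r ∧ ∃ (P : ℕ → Ideal R) (M N : Ideal R),
            M ≠ N ∧
            {I : Ideal R | I.IsMaximal} = {M, N} ∧
            {I : Ideal R | I.IsPrime} = P '' Set.Iic r ∪ {N} ∧
            P 0 = ⊥ ∧ StrictMonoOn P (Set.Iic r) ∧ P r = M ∧
            ¬ P (r - 4) ≤ N ∧ P (r - 5) < N) ∨
          -- (c)
          (2 ≤ r ∧ ∃ (P : ℕ → Ideal R) (M N Q : Ideal R),
            M ≠ N ∧
            {I : Ideal R | I.IsMaximal} = {M, N} ∧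
            {I : Ideal R | I.IsPrime} = P '' Set.Iic r ∪ {Q, N} ∧
            P 0 = ⊥ ∧ StrictMonoOn P (Set.Iic r) ∧ P r = M ∧
            Q ∉ P '' Set.Iic r ∧ P (r - 2) < Q ∧ Q < N))] := by
  have hfinite : ∀ {c : ℕ∞}, c ≤ 7 + r → c < ⊤ := fun h =>
    h.trans_lt (by exact_mod_cast ENat.natCast_lt_top (7 + r))
  tfae_have 1 → 2 := by
    intro h
    have : Finite (Subalgebra R K) := ENat.card_lt_top.1 (hfinite h.le)
    have hR : IsLocallyValuation R := isLocallyValuation_of_finite_subalgebra (K := K)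
    rwa [← hR.card_subalgebra_eq_card_semistarOperation]
  tfae_have 2 → 1 := by
    intro h
    have : Finite (Subalgebra R K) :=
      ENat.card_lt_top.1 (hfinite (card_subalgebra_le_card_semistarOperation.trans h.le))
    have hR : IsLocallyValuation R := isLocallyValuation_of_finite_subalgebra (K := K)
    rwa [hR.card_subalgebra_eq_card_semistarOperation]
  tfae_have 1 → 3 := by
    intro h
    have : Finite (Subalgebra R K) := ENat.card_lt_top.1 (hfinite h.le)
    have hR : IsLocallyValuation R := isLocallyValuation_of_finite_subalgebra (K := K)
    have hfin : {I : Ideal R | I.IsPrime}.Finite :=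
      finite_setOf_isPrime_of_finite_subalgebra (K := K)
    obtain ⟨P, hP⟩ := exists_isMaximalBranch hr hR
    have h0 : P 0 = ⊥ := le_bot_iff.1 (hP.bot_le ⊥ Ideal.isPrime_bot)
    have hmem : ∀ {U : Set (Ideal R)}, offBranch {I : Ideal R | I.IsPrime} r P = U →
        ∀ {I}, I ∈ U → I ∈ offBranch {I : Ideal R | I.IsPrime} r P := fun hU _ hI => hU ▸ hI
    have hPne : ∀ {I}, I ∈ offBranch {I : Ideal R | I.IsPrime} r P → P r ≠ I := by
      rintro I hI rfl
      exact hI.2 le_rfl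
    refine ⟨hR.isPruferDomain, ?_⟩
    rcases (hR.card_subalgebra_eq_iff hr hfin hP).1 h with ⟨h1, u, v, huv, hvu, hU, hu, hv⟩ |
      ⟨h5, u, hU, hu, hu'⟩ | ⟨h2, u, v, huv, hU, hu⟩
    · have huU := hmem hU (Set.mem_insert u {v})
      have hvU := hmem hU (Set.mem_insert_of_mem u rfl)
      have hlt := hP.strictMonoOn (Set.mem_Iic.2 (Nat.sub_le r 1)) (Set.mem_Iic.2 le_rfl)
        (Nat.sub_lt h1 one_pos)
      refine Or.inl ⟨h1, P, P r, u, v, hPne huU, hPne hvU, fun h => huv h.le, ?_, ?_, h0,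
        hP.strictMonoOn.mono (Set.Iic_subset_Iic.2 (Nat.sub_le r 1)), ?_⟩
      · ext I
        rw [Set.mem_ofPred_eq, hP.isMaximal_iff, hU]
        simp only [Set.mem_insert_iff, Set.mem_singleton_iff]
        refine or_congr_right ⟨fun h => h.1, ?_⟩
        rintro (rfl | rfl)
        · exact ⟨Or.inl rfl, fun J hJ hle => hJ.resolve_right fun h => huv (h ▸ hle)⟩
        · exact ⟨Or.inr rfl, fun J hJ hle => hJ.resolve_left fun h => hvu (h ▸ hle)⟩
      · ext I
        rw [Set.mem_ofPred_eq, hP.isPrime_iff, hU]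
        constructor
        · rintro (⟨i, hi, rfl⟩ | hI)
          · rcases hi.lt_or_eq with hlt | rfl
            · exact Or.inl ⟨i, Set.mem_Iic.2 (by omega), rfl⟩
            · exact Or.inr (Or.inl rfl)
          · exact Or.inr (Or.inr hI)
        · rintro (⟨i, hi, rfl⟩ | rfl | hI)
          · exact Or.inl ⟨i, le_trans hi (Nat.sub_le r 1), rfl⟩
          · exact Or.inl ⟨r, le_rfl, rfl⟩
          · exact Or.inr hI
      · refine lt_of_le_not_ge (le_inf (le_inf hlt.le hu) hv) fun hle => ?_
        -- a prime containing the intersection contains one of the three ideals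
        have hprime : (P (r - 1)).IsPrime := hP.mem (Nat.sub_le r 1)
        rcases hprime.inf_le.1 hle with hle | hle
        · rcases hprime.inf_le.1 hle with hle | hle
          · exact hlt.not_ge hle
          · exact (hP.lt_of_le (Nat.sub_le r 1) huU hu).not_ge hle
        · exact (hP.lt_of_le (Nat.sub_le r 1) hvU hv).not_ge hle
    · have huU := hmem hU (Set.mem_singleton u)
      refine Or.inr (Or.inl ⟨h5, P, P r, u, hPne huU, ?_, ?_, h0, hP.strictMonoOn, rfl, hu',
        hP.lt_of_le (Nat.sub_le r 5) huU hu⟩)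
      · ext I
        rw [Set.mem_ofPred_eq, hP.isMaximal_iff, hU]
        simp only [Set.mem_insert_iff, Set.mem_singleton_iff]
        refine or_congr_right ⟨fun h => h.1, ?_⟩
        rintro rfl
        exact ⟨rfl, fun J hJ _ => hJ⟩
      · ext I
        rw [Set.mem_ofPred_eq, hP.isPrime_iff, hU]
        rfl
    · have huU := hmem hU (Set.mem_insert u {v})
      have hvU := hmem hU (Set.mem_insert_of_mem u rfl)
      refine Or.inr (Or.inr ⟨h2, P, P r, v, u, hPne hvU, ?_, ?_, h0, hP.strictMonoOn, rfl, ?_,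
        hP.lt_of_le (Nat.sub_le r 2) huU hu, huv⟩)
      · ext I
        rw [Set.mem_ofPred_eq, hP.isMaximal_iff, hU]
        simp only [Set.mem_insert_iff, Set.mem_singleton_iff]
        refine or_congr_right ⟨?_, ?_⟩
        · rintro ⟨rfl | rfl, h⟩
          · exact absurd (h v (Or.inr rfl) huv.le) huv.ne'
          · rfl
        · rintro rfl
          refine ⟨Or.inr rfl, fun J hJ hle => hJ.resolve_left ?_⟩
          rintro rfl
          exact huv.not_ge hle
      · ext I
        rw [Set.mem_ofPred_eq, hP.isPrime_iff, hU]
        rfl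
      · rintro ⟨i, hi, rfl⟩
        exact huU.2 (hP.le_top hi)
  tfae_have 3 → 1 := by
    rintro ⟨hpr, hcases⟩
    have hR := hpr.isLocallyValuation
    rcases hcases with ⟨h1, P, M₁, M₂, M₃, h12, h13, h23, hmax, hprime, h0, hmono, hlt⟩ |
      ⟨h5, P, M, N, hMN, hmax, hprime, h0, hmono, rfl, hN, hN'⟩ |
      ⟨h2, P, M, N, Q, hMN, hmax, hprime, h0, hmono, rfl, hQ, hPQ, hQN⟩
    · have hM₁ : M₁.IsMaximal := hmax.ge (by simp)
      have hM₂ : M₂.IsMaximal := hmax.ge (by simp)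
      have hM₃ : M₃.IsMaximal := hmax.ge (by simp)
      have hl₁ : P (r - 1) < M₁ := hlt.trans_le (inf_le_left.trans inf_le_left)
      have hl₂ : P (r - 1) ≤ M₂ := hlt.le.trans (inf_le_left.trans inf_le_right)
      have hl₃ : P (r - 1) ≤ M₃ := hlt.le.trans inf_le_right
      have hfin : {I : Ideal R | I.IsPrime}.Finite := by
        rw [hprime]
        exact ((Set.finite_Iic _).image _).union (Set.toFinite _)
      -- the branch through `M₁`
      let P' : ℕ → Ideal R := Function.update P r M₁
      have hP'r : P' r = M₁ := Function.update_self ..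
      have hP' : ∀ i, i ≤ r - 1 → P' i = P i := fun i hi =>
        Function.update_of_ne (by omega) ..
      have hPle : ∀ i ≤ r - 1, P i ≤ P (r - 1) := fun i hi =>
        (hmono.le_iff_le (Set.mem_Iic.2 hi) (Set.mem_Iic.2 le_rfl)).2 hi
      have hbranch : IsMaximalBranch {I : Ideal R | I.IsPrime} r P' := by
        refine isMaximalBranch_of_isMaximal ?_ ?_ ?_ (hP'r ▸ hM₁) ?_
        · rw [hP' 0 (Nat.zero_le _), h0]
        · intro i hi j hj hij
          simp only [Set.mem_Iic] at hi hj
          rcases hj.lt_or_eq with hjr | rfl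
          · rw [hP' i (by omega), hP' j (by omega)]
            exact hmono (Set.mem_Iic.2 (by omega)) (Set.mem_Iic.2 (by omega)) hij
          · rw [hP' i (by omega), hP'r]
            exact (hPle i (by omega)).trans_lt hl₁
        · intro i hi
          rcases hi.lt_or_eq with hir | rfl
          · rw [hP' i (by omega)]
            exact hprime.ge (Or.inl ⟨i, Set.mem_Iic.2 (by omega), rfl⟩)
          · rw [hP'r]
            exact hM₁.isPrime
        · intro I hI hle
          rw [hP'r] at hle
          rcases hprime.le hI with ⟨i, hi, rfl⟩ | rfl | rfl | rfl
          · exact ⟨i, le_trans hi (Nat.sub_le r 1), hP' i hi⟩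
          · exact ⟨r, le_rfl, hP'r⟩
          · exact absurd (hM₂.eq_of_le hM₁.ne_top hle).symm h12
          · exact absurd (hM₃.eq_of_le hM₁.ne_top hle).symm h13
      refine (hR.card_subalgebra_eq_iff hr hfin hbranch).2 (Or.inl ⟨h1, M₂, M₃,
        fun hle => h23 (hM₂.eq_of_le hM₃.ne_top hle),
        fun hle => h23 (hM₃.eq_of_le hM₂.ne_top hle).symm, ?_,
        (hP' _ le_rfl).trans_le hl₂, (hP' _ le_rfl).trans_le hl₃⟩)
      ext I
      constructor
      · rintro ⟨hI, hle⟩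
        rw [hP'r] at hle
        rcases hprime.le hI with ⟨i, hi, rfl⟩ | rfl | hI
        · exact absurd ((hPle i hi).trans hl₁.le) hle
        · exact absurd le_rfl hle
        · exact hI
      · rintro (rfl | rfl)
        · exact ⟨hM₂.isPrime, fun hle => h12 (hM₂.eq_of_le hM₁.ne_top (hP'r ▸ hle)).symm⟩
        · exact ⟨hM₃.isPrime, fun hle => h13 (hM₃.eq_of_le hM₁.ne_top (hP'r ▸ hle)).symm⟩
    · have hM : (P r).IsMaximal := hmax.ge (by simp)
      have hNmax : N.IsMaximal := hmax.ge (by simp)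
      have hNM : ¬ N ≤ P r := fun hle => hMN (hNmax.eq_of_le hM.ne_top hle).symm
      have hfin : {I : Ideal R | I.IsPrime}.Finite := by
        rw [hprime]
        exact ((Set.finite_Iic _).image _).union (Set.toFinite _)
      have hbranch : IsMaximalBranch {I : Ideal R | I.IsPrime} r P := by
        refine isMaximalBranch_of_isMaximal h0 hmono
          (fun i hi => hprime.ge (Or.inl ⟨i, hi, rfl⟩)) hM fun I hI hle => ?_
        rcases hprime.le hI with ⟨i, hi, rfl⟩ | rfl
        · exact ⟨i, hi, rfl⟩
        · exact absurd hle hNM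
      refine (hR.card_subalgebra_eq_iff hr hfin hbranch).2
        (Or.inr (Or.inl ⟨h5, N, ?_, hN'.le, hN⟩))
      ext I
      constructor
      · rintro ⟨hI, hle⟩
        rcases hprime.le hI with ⟨i, hi, rfl⟩ | hI
        · exact absurd (hbranch.le_top hi) hle
        · exact hI
      · rintro rfl
        exact ⟨hNmax.isPrime, hNM⟩
    · have hM : (P r).IsMaximal := hmax.ge (by simp)
      have hNmax : N.IsMaximal := hmax.ge (by simp)
      have hNM : ¬ N ≤ P r := fun hle => hMN (hNmax.eq_of_le hM.ne_top hle).symm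
      have hQp : Q.IsPrime := hprime.ge (Or.inr (Or.inl rfl))
      have hp : ∀ i ≤ r, (P i).IsPrime := fun i hi => hprime.ge (Or.inl ⟨i, hi, rfl⟩)
      -- otherwise `Q` would refine the chain just below or just above `P (r - 1)`
      have hQM : ¬ Q ≤ P r := by
        intro hle
        have hne : ∀ i ≤ r, P i ≠ Q := fun i hi h => hQ ⟨i, hi, h⟩
        have h1r : P (r - 1) ≤ P r :=
          (hmono.le_iff_le (Set.mem_Iic.2 (Nat.sub_le r 1)) (Set.mem_Iic.2 le_rfl)).2
            (Nat.sub_le r 1)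
        rcases hR.le_or_le (hp _ (Nat.sub_le r 1)) hQp hM.isPrime h1r hle with h | h
        · refine not_lt_of_lt_of_ringKrullDim_eq hr hmono hp hQp (k := r - 1) (by omega)
            (lt_of_le_of_ne h (hne _ (Nat.sub_le r 1))) ?_
          rw [Nat.sub_add_cancel (by omega)]
          exact lt_of_le_of_ne hle (hne r le_rfl).symm
        · refine not_lt_of_lt_of_ringKrullDim_eq hr hmono hp hQp (k := r - 2) (by omega) hPQ ?_
          rw [show r - 2 + 1 = r - 1 by omega]
          exact lt_of_le_of_ne h (hne _ (Nat.sub_le r 1)).symm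
      have hfin : {I : Ideal R | I.IsPrime}.Finite := by
        rw [hprime]
        exact ((Set.finite_Iic _).image _).union (Set.toFinite _)
      have hbranch : IsMaximalBranch {I : Ideal R | I.IsPrime} r P := by
        refine isMaximalBranch_of_isMaximal h0 hmono hp hM fun I hI hle => ?_
        rcases hprime.le hI with ⟨i, hi, rfl⟩ | rfl | rfl
        · exact ⟨i, hi, rfl⟩
        · exact absurd hle hQM
        · exact absurd hle hNM
      refine (hR.card_subalgebra_eq_iff hr hfin hbranch).2
        (Or.inr (Or.inr ⟨h2, Q, N, hQN, ?_, hPQ.le⟩))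
      ext I
      constructor
      · rintro ⟨hI, hle⟩
        rcases hprime.le hI with ⟨i, hi, rfl⟩ | hI
        · exact absurd (hbranch.le_top hi) hle
        · exact hI
      · rintro (rfl | rfl)
        · exact ⟨hQp, hQM⟩
        · exact ⟨hNmax.isPrime, hNM⟩
  tfae_finish
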